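/- **Conventions.** All spaces are complex vector spaces. A cochain complex is $V^{[*]}=\bigoplus_{p\in\mathbb Z}V^{[p]}$ with a linear map $d_V$, $d_V(V^{[p]})\subseteq V^{[p+1]}$, $d_V^2=0$; we write $|v|=p$ for $v\in V^{[p]}$. A *dg vertex algebra* is a cochain complex $V^{[*]}$ with a vector $\mathbf 1\in V^{[0]}$, $d_V\mathbf 1=0$, and a linear map $v\mapsto Y(v,x)=\sum_{n\in\mathbb Z}v_nx^{-n-1}$, $v_n\in\mathrm{End}(V)$, such that: $Y(u,x)v\in V((x))$ for all $u,v$; $Y$ is a chain map with $x$ of degree $-2$, i.e. for $v\in V^{[p]}$ the operator $v_n$ has degree $p-2n-2$ and $(d_Vv)_n=d_V\circ v_n-(-1)^{p}v_n\circ d_V$; $Y(\mathbf 1,x)=\mathrm{id}$; $Y(v,x)\mathbf 1\in V[[x]]$ with constant term $v$; and the Jacobi identity $$x_2^{-1}\delta\Big(\tfrac{x_1-x_0}{x_2}\Big)Y(Y(u,x_0)v,x_2)=x_0^{-1}\delta\Big(\tfrac{x_1-x_2}{x_0}\Big)Y(u,x_1)Y(v,x_2)-(-1)^{|u||v|}x_0^{-1}\delta\Big(\tfrac{x_2-x_1}{-x_0}\Big)Y(v,x_2)Y(u,x_1)$$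 holds for homogeneous $u,v$. It is a *dg vertex operator algebra* (dg VOA) if it is equipped with $\omega\in V^{[4]}$, $d_V\omega=0$, $Y(\omega,x)=\sum_n L(n)x^{-n-2}$, such that the $L(n)$ satisfy the Virasoro relations with some central charge $c_V\in\mathbb C$; $V=\bigoplus_{n\in\frac12\mathbb Z}V_n$, where $V_n$ is the $n$-eigenspace of $L(0)$ (for $u\in V_n$ write $\mathrm{wt}\,u=n$), with $\dim V_n<\infty$, $V_n=0$ for $n\ll0$ and $\omega\in V_2$; and $L(-1)v=v_{-2}\mathbf 1$ for all $v$. A *weak dg module* over $V^{[*]}$ is a cochain complex $(M^{[*]},d_M)$ with a linear map $u\mapsto Y_M(u,z)=\sum_n u_nz^{-n-1}$, $u_n\in\mathrm{End}(M)$, such that $Y_M(u,z)m\in M((z))$, $Y_M$ is a chain map in the same sense, $Y_M(\mathbf 1,z)=\mathrm{id}_M$, and the Jacobi identity above holds with $Y_M(Y(u,x_0)v,x_2)$ on the left and $Y_M$ in place of $Y$ on the right. For $\alpha\in\mathbb C$, $(1+z)^\alpha=\sum_{n\ge0}\binom{\alpha}{n}z^n$. Let $V^{[*]}$ be a dg VOA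 and $M^{[*]}$ a weak dg module. Let $O(M)\subseteq M$ be the span of all $$u\circ m=\mathrm{Res}_z\,Y_M(u,z)\frac{(1+z)^{\mathrm{wt}\,u}}{z^2}m,\qquad u\in V \text{ weight homogeneous},\ m\in M,$$ and $A(M)=M/O(M)$; in particular, taking $M=V$, let $A(V)=V/O(V)$. Write $[\,\cdot\,]$ for classes. **Theorem.** The following formulas, extended linearly, give well-defined bilinear operations on the quotients: $$[u]\ast[v]=\Big[\mathrm{Res}_z\,Y(u,z)\tfrac{(1+z)^{\mathrm{wt}\,u}}{z}v\Big],\qquad [u]\ast_l[m]=\Big[\mathrm{Res}_z\,Y_M(u,z)\tfrac{(1+z)^{\mathrm{wt}\,u}}{z}m\Big],$$ $$[m]\ast_r[u]=(-1)^{|u||m|}\Big[\mathrm{Res}_z\,Y_M(u,z)\tfrac{(1+z)^{\mathrm{wt}\,u-1}}{z}m\Big]$$ (for $u$ weight homogeneous and, in the last formula, $u$ and $m$ also homogeneous of degrees $|u|$, $|m|$). With them $A(V)$ is an associative algebra with unit $[\mathbf 1]$, and $A(M)$ is a unital $A(V)$-bimodule: for $a,b\in A(V)$ and $x\in A(M)$,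 $$(a\ast b)\ast_l x=a\ast_l(b\ast_l x),\quad x\ast_r(a\ast b)=(x\ast_r a)\ast_r b,\quad (a\ast_l x)\ast_r b=a\ast_l(x\ast_r b),\quad [\mathbf 1]\ast_l x=x=x\ast_r[\mathbf 1].$$ Moreover $d_V$ and $d_M$ induce square-zero maps $d$ on $A(V)$ and $A(M)$. Let $F^pA(V)$ and $F^pA(M)$ be the images of $\bigoplus_{q\le p}V^{[q]}$ and $\bigoplus_{q\le p}M^{[q]}$. These are increasing exhaustive filtrations with $dF^p\subseteq F^{p+1}$, and each of the three operations, written $\cdot$, satisfies $F^i\cdot F^j\subseteq F^{i+j}$ and $d(x\cdot y)-\big(dx\cdot y+(-1)^{i}x\cdot dy\big)\in F^{i+j}$ for $x\in F^i$, $y\in F^j$. -/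

import Mathlib

noncomputable section

/-- A cochain complex over `ℂ`, given by its total space `V = ⨁ₚ V^[p]` and the
differential `d` of degree one. -/
structure DGSpace (V : Type*) [AddCommGroup V] [Module ℂ V] where
  deg : ℤ → Submodule ℂ V
  deg_internal : DirectSum.IsInternal deg
  d : V →ₗ[ℂ] V
  d_mem : ∀ (p : ℤ), ∀ v ∈ deg p, d v ∈ deg (p + 1)
  d_d : ∀ v, d (d v) = 0

/-- `mode Y n u w` is `u_n w`, where `Y(u, x) = ∑ₙ u_n x^(-n-1)`. -/
def mode {V M : Type*} [AddCommGroup V] [Module ℂ V] [AddCommGroup M] [Module ℂ M]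
    (Y : V →ₗ[ℂ] VertexOperator ℂ M) (n : ℤ) (u : V) (w : M) : M :=
  VertexOperator.ncoeff (Y u) n w

/-- The map `Y(·, x)`, with `x` of degree `-2`, is a morphism of complexes
`V → End(M)[[x, x⁻¹]]`: for `u` of degree `p` the operator `u_n` has degree `p - 2n - 2`,
and `(d u)_n = d ∘ u_n - (-1)^p u_n ∘ d`. -/
structure IsChainVertexMap {V M : Type*} [AddCommGroup V] [Module ℂ V] [AddCommGroup M]
    [Module ℂ M] (C : DGSpace V) (D : DGSpace M) (Y : V →ₗ[ℂ] VertexOperator ℂ M) : Prop where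
  mode_mem : ∀ (p q n : ℤ), ∀ u ∈ C.deg p, ∀ w ∈ D.deg q,
    mode Y n u w ∈ D.deg (p + q - 2 * n - 2)
  mode_d : ∀ (p n : ℤ), ∀ u ∈ C.deg p, ∀ w : M,
    mode Y n (C.d u) w = D.d (mode Y n u w) - (-1 : ℂ) ^ p • mode Y n u (D.d w)

/-- The Jacobi identity with Koszul signs, for homogeneous `u` and `v`: the coefficients of
`x₀^(-l-1) x₁^(-m-1) x₂^(-n-1)` on its two sides agree on every vector `w`.  By truncation each
sum has finitely many nonzero terms. -/
def JacobiIdentity {V M : Type*} [AddCommGroup V] [Module ℂ V] [AddCommGroup M] [Module ℂ M]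
    (C : DGSpace V) (Y : V →ₗ[ℂ] VertexOperator ℂ V) (YM : V →ₗ[ℂ] VertexOperator ℂ M) : Prop :=
  ∀ (p q : ℤ), ∀ u ∈ C.deg p, ∀ v ∈ C.deg q, ∀ (l m n : ℤ) (w : M),
    (∑ᶠ i : ℕ, ((-1 : ℂ) ^ i * Ring.choose (l : ℂ) i) •
        (mode YM (m + l - i) u (mode YM (n + i) v w)
          - ((-1 : ℂ) ^ l * (-1 : ℂ) ^ (p * q)) •
              mode YM (n + l - i) v (mode YM (m + i) u w)))
      = ∑ᶠ i : ℕ, Ring.choose (m : ℂ) i • mode YM (m + n - i) (mode Y (l + i) u v) w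

/-- A dg vertex algebra.  The truncation property is part of `VertexOperator`, whose values are
formal Laurent series. -/
structure DGVertexAlgebra (V : Type*) [AddCommGroup V] [Module ℂ V] extends DGSpace V where
  Y : V →ₗ[ℂ] VertexOperator ℂ V
  chain : IsChainVertexMap toDGSpace toDGSpace Y
  vac : V
  vac_mem : vac ∈ deg 0
  d_vac : d vac = 0
  vac_mode : ∀ (n : ℤ) (w : V), mode Y n vac w = if n = -1 then w else 0
  creation : ∀ v, mode Y (-1) v vac = v
  creation_nonneg : ∀ (n : ℤ) (v : V), 0 ≤ n → mode Y n v vac = 0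
  jacobi : JacobiIdentity toDGSpace Y Y

/-- A dg module over a dg vertex algebra. -/
structure DGModule {V : Type*} [AddCommGroup V] [Module ℂ V] (A : DGVertexAlgebra V)
    (M : Type*) [AddCommGroup M] [Module ℂ M] extends DGSpace M where
  Y : V →ₗ[ℂ] VertexOperator ℂ M
  chain : IsChainVertexMap A.toDGSpace toDGSpace Y
  vac_mode : ∀ (n : ℤ) (w : M), mode Y n A.vac w = if n = -1 then w else 0
  jacobi : JacobiIdentity A.toDGSpace A.Y Y

/-- A dg vertex algebra as a dg module over itself. -/
def DGVertexAlgebra.adjoint {V : Type*} [AddCommGroup V] [Module ℂ V] (A : DGVertexAlgebra V) :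
    DGModule A V where
  toDGSpace := A.toDGSpace
  Y := A.Y
  chain := A.chain
  vac_mode := A.vac_mode
  jacobi := A.jacobi

/-- The operator `L(n) = ω_{n+1}` attached to a vector `ω` of a dg vertex algebra. -/
def DGVertexAlgebra.virasoro {V : Type*} [AddCommGroup V] [Module ℂ V] (A : DGVertexAlgebra V)
    (ω : V) (n : ℤ) : Module.End ℂ V :=
  VertexOperator.ncoeff (A.Y ω) (n + 1)

/-- The eigenspace of `L(0)` for the eigenvalue `k / 2`. -/
def DGVertexAlgebra.halfWeightSpace {V : Type*} [AddCommGroup V] [Module ℂ V]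
    (A : DGVertexAlgebra V) (ω : V) (k : ℤ) : Submodule ℂ V :=
  (A.virasoro ω 0).eigenspace ((k : ℂ) / 2)

/-- A dg vertex operator algebra.  Weights lie in `½ℤ`; the integer `k` indexes the space of
vectors of weight `k / 2`. -/
structure DGVOA (V : Type*) [AddCommGroup V] [Module ℂ V] extends DGVertexAlgebra V where
  ω : V
  ω_mem : ω ∈ deg 4
  d_ω : d ω = 0
  centralCharge : ℂ
  virasoro_comm : ∀ m n : ℤ,
    toDGVertexAlgebra.virasoro ω m * toDGVertexAlgebra.virasoro ω n
        - toDGVertexAlgebra.virasoro ω n * toDGVertexAlgebra.virasoro ω m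
      = ((m : ℂ) - n) • toDGVertexAlgebra.virasoro ω (m + n)
        + (if m + n = 0 then ((m : ℂ) ^ 3 - m) / 12 * centralCharge else 0) •
            (1 : Module.End ℂ V)
  weight_internal : DirectSum.IsInternal (toDGVertexAlgebra.halfWeightSpace ω)
  ω_weight : ω ∈ toDGVertexAlgebra.halfWeightSpace ω 4
  weight_finite : ∀ k : ℤ, FiniteDimensional ℂ (toDGVertexAlgebra.halfWeightSpace ω k)
  weight_bounded : ∃ N : ℤ, ∀ k < N, toDGVertexAlgebra.halfWeightSpace ω k = ⊥
  virasoro_neg_one : ∀ v, toDGVertexAlgebra.virasoro ω (-1) v = mode Y (-2) v vac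

/-- The vectors of weight `k / 2` of a dg vertex operator algebra. -/
def DGVOA.weight {V : Type*} [AddCommGroup V] [Module ℂ V] (A : DGVOA V) (k : ℤ) :
    Submodule ℂ V :=
  A.toDGVertexAlgebra.halfWeightSpace A.ω k

/-- A weak dg module over a dg vertex operator algebra is a dg module over the underlying
dg vertex algebra. -/
abbrev WeakDGModule {V : Type*} [AddCommGroup V] [Module ℂ V] (A : DGVOA V)
    (M : Type*) [AddCommGroup M] [Module ℂ M] :=
  DGModule A.toDGVertexAlgebra M

/-- `Res_z (Y(u, z) (1 + z)^α / z^s m) = ∑_{n ≥ 0} (α choose n) u_{n-s} m`. -/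
def DGModule.res {V : Type*} [AddCommGroup V] [Module ℂ V] {A : DGVertexAlgebra V}
    {M : Type*} [AddCommGroup M] [Module ℂ M] (N : DGModule A M)
    (α : ℂ) (s : ℤ) (u : V) (m : M) : M :=
  ∑ᶠ n : ℕ, Ring.choose α n • mode N.Y (n - s) u m

/-- `O(M)`, the span of the `u ∘ m = Res_z (Y(u, z) (1 + z)^(wt u) / z² m)`, for `u`
homogeneous with respect to the weight. -/
def zhuO {V : Type*} [AddCommGroup V] [Module ℂ V] (A : DGVOA V)
    {M : Type*} [AddCommGroup M] [Module ℂ M] (N : WeakDGModule A M) : Submodule ℂ M :=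
  Submodule.span ℂ {x | ∃ k : ℤ, ∃ u ∈ A.weight k, ∃ m : M, x = N.res ((k : ℂ) / 2) 2 u m}

/-- `A(M) = M / O(M)`. -/
abbrev ZhuA {V : Type*} [AddCommGroup V] [Module ℂ V] (A : DGVOA V)
    {M : Type*} [AddCommGroup M] [Module ℂ M] (N : WeakDGModule A M) :=
  M ⧸ zhuO A N

/-- The class `[m]` of `m` in `A(M)`. -/
abbrev zhuClass {V : Type*} [AddCommGroup V] [Module ℂ V] (A : DGVOA V)
    {M : Type*} [AddCommGroup M] [Module ℂ M] (N : WeakDGModule A M) : M →ₗ[ℂ] ZhuA A N :=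
  (zhuO A N).mkQ

/-- `F^p A(M)`, the image of `⨁_{q ≤ p} M^[q]` in `A(M)`. -/
def zhuF {V : Type*} [AddCommGroup V] [Module ℂ V] (A : DGVOA V)
    {M : Type*} [AddCommGroup M] [Module ℂ M] (N : WeakDGModule A M) (p : ℤ) :
    Submodule ℂ (ZhuA A N) :=
  (⨆ (q : ℤ) (_ : q ≤ p), N.deg q).map (zhuClass A N)

/-- `mul` is an associative multiplication with two-sided unit `one`. -/
structure IsAssocAlgebra {B : Type*} [AddCommGroup B] [Module ℂ B]
    (mul : B →ₗ[ℂ] B →ₗ[ℂ] B) (one : B) : Prop where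
  assoc : ∀ a b c, mul (mul a b) c = mul a (mul b c)
  one_mul : ∀ a, mul one a = a
  mul_one : ∀ a, mul a one = a

/-- `l` and `r` make `X` a unital bimodule over the algebra with product `mul`, unit `one`. -/
structure IsBimodule {B X : Type*} [AddCommGroup B] [Module ℂ B] [AddCommGroup X] [Module ℂ X]
    (mul : B →ₗ[ℂ] B →ₗ[ℂ] B) (one : B)
    (l : B →ₗ[ℂ] X →ₗ[ℂ] X) (r : X →ₗ[ℂ] B →ₗ[ℂ] X) : Prop where
  left_one : ∀ x, l one x = x
  left_mul : ∀ a b x, l (mul a b) x = l a (l b x)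
  right_one : ∀ x, r x one = x
  right_mul : ∀ x a b, r x (mul a b) = r (r x a) b
  left_right : ∀ a x b, r (l a x) b = l a (r x b)

/-- `F` is an increasing exhaustive filtration and `d` a square-zero map raising it by one. -/
structure IsDiffFiltration {X : Type*} [AddCommGroup X] [Module ℂ X]
    (F : ℤ → Submodule ℂ X) (d : X →ₗ[ℂ] X) : Prop where
  mono : Monotone F
  exhaustive : ∀ x, ∃ i, x ∈ F i
  d_mem : ∀ (i : ℤ), ∀ x ∈ F i, d x ∈ F (i + 1)
  d_d : ∀ x, d (d x) = 0

/-- A bilinear map is compatible with filtrations, and the differentials obey the Leibniz rule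
up to terms of lower filtration. -/
structure IsDiffFilteredPairing {X X' X'' : Type*} [AddCommGroup X] [Module ℂ X]
    [AddCommGroup X'] [Module ℂ X'] [AddCommGroup X''] [Module ℂ X'']
    (F : ℤ → Submodule ℂ X) (d : X →ₗ[ℂ] X) (F' : ℤ → Submodule ℂ X') (d' : X' →ₗ[ℂ] X')
    (F'' : ℤ → Submodule ℂ X'') (d'' : X'' →ₗ[ℂ] X'') (b : X →ₗ[ℂ] X' →ₗ[ℂ] X'') : Prop where
  mem : ∀ (i j : ℤ), ∀ x ∈ F i, ∀ y ∈ F' j, b x y ∈ F'' (i + j)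
  leibniz : ∀ (i j : ℤ), ∀ x ∈ F i, ∀ y ∈ F' j,
    d'' (b x y) - (b (d x) y + (-1 : ℂ) ^ i • b x (d' y)) ∈ F'' (i + j)

end

/-! Each operation is a residue of $f(z)Y(u,z)$ with $f=(1+z)^\alpha z^{-s}$. Pairing the Jacobi
identity with a test series in $x_1$ and one in $x_2$ (`residue_jacobi`) gives commutator and
iterate formulas for such residues, and Zhu's argument then runs with Koszul signs on three facts.

Pole order (`bres_mem_zhuO`): since $Y(L(-1)u,z)$ is the derivative of $Y(u,z)$, the series
$(1+z)^{\mathrm{wt}\,u+n}z^{-s}$ with $s\ge n+2$ sends $M$ into $O(M)$.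

Commutator (`bres_comm_mem_zhuO`): if the exponents of $1+z$ add up to
$\mathrm{wt}\,u+\mathrm{wt}\,v-1+n$ and the poles have orders $1$ and $t\ge n+1$, the two residues
supercommute modulo $O(M)$. Hence the left and right actions preserve $O(M)$ and commute with each
other.

Iterate (`zhuOp_bres`): the actions of $u\circ v$ and $u\ast v$ expand into double residues. Those
of $u\circ v$ all lie in $O(M)$; for the left action of $u\ast v$ one term survives; for the right
action the surviving terms telescope to the product in the opposite order (`mkQ_zhuOp_star`).

The differential preserves weights because $d\omega=0$, so it preserves $O(M)$, and the Leibniz rule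
is exact on homogeneous representatives. The products involve only $u_n$ with $n\ge-1$, of degree
$|u|-2n-2\le|u|$ and of the parity of $|u|$. Thus the grading weakens to a filtration, while Koszul
signs keep their meaning. -/

noncomputable section

open Finset

/-! ### Laurent series and Hasse derivatives. -/

/-- The algebra of formal Laurent series with complex coefficients. -/
def Laurent : Type := LaurentSeries ℂ

instance : CommRing Laurent := inferInstanceAs (CommRing (LaurentSeries ℂ))

instance : Algebra ℂ Laurent :=
  RingHom.toAlgebra (S := Laurent) (HahnSeries.C : ℂ →+* LaurentSeries ℂ)

namespace Laurent

/-- The coefficient of `z^n`. -/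
def coeff (n : ℤ) : Laurent →ₗ[ℂ] ℂ where
  toFun f := HahnSeries.coeff f n
  map_add' _ _ := rfl
  map_smul' c f := by
    rw [Algebra.smul_def]
    exact HahnSeries.coeff_single_zero_mul

@[ext]
theorem ext {f g : Laurent} (h : ∀ n, coeff n f = coeff n g) : f = g :=
  HahnSeries.ext (funext h)

/-- The series `z^n`. -/
def monomial (n : ℤ) : Laurent := HahnSeries.single n (1 : ℂ)

theorem coeff_monomial (m n : ℤ) : coeff m (monomial n) = if m = n then 1 else 0 := by
  refine HahnSeries.coeff_single.trans ?_
  simp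

@[simp]
theorem coeff_monomial_self (n : ℤ) : coeff n (monomial n) = 1 := by
  simp [coeff_monomial]

theorem coeff_monomial_of_ne {m n : ℤ} (h : m ≠ n) : coeff m (monomial n) = 0 := by
  simp [coeff_monomial, h]

theorem coeff_monomial_mul (m n : ℤ) (f : Laurent) :
    coeff n (monomial m * f) = coeff (n - m) f := by
  have h := HahnSeries.coeff_single_mul_add (r := (1 : ℂ)) (x := f) (a := n - m) (b := m)
  rw [sub_add_cancel, one_mul] at h
  exact h

@[simp]
theorem monomial_zero : monomial 0 = 1 := rfl

theorem monomial_mul_monomial (m n : ℤ) : monomial m * monomial n = monomial (m + n) := by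
  ext k
  rw [coeff_monomial_mul, coeff_monomial, coeff_monomial]
  congr 1
  exact propext ⟨fun h => by omega, fun h => by omega⟩

/-- The inclusion of formal power series. -/
def ofPowerSeries : PowerSeries ℂ →+* Laurent := HahnSeries.ofPowerSeries ℤ ℂ

theorem coeff_ofPowerSeries_nat (f : PowerSeries ℂ) (n : ℕ) :
    coeff n (ofPowerSeries f) = PowerSeries.coeff n f :=
  HahnSeries.ofPowerSeries_apply_coeff f n

theorem coeff_ofPowerSeries_of_neg (f : PowerSeries ℂ) {n : ℤ} (h : n < 0) :
    coeff n (ofPowerSeries f) = 0 := by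
  change (HahnSeries.ofPowerSeries ℤ ℂ f).coeff n = 0
  rw [HahnSeries.ofPowerSeries_apply, HahnSeries.embDomain_of_notMem_range]
  rintro ⟨k, hk⟩
  have : (k : ℤ) = n := hk
  omega

/-- The Hasse derivative `(1 / i!) (d/dz)^i`. -/
def hasseDeriv (i : ℕ) : Laurent →ₗ[ℂ] Laurent where
  toFun f := LaurentSeries.hasseDeriv ℂ i (f : LaurentSeries ℂ)
  map_add' f g := map_add (LaurentSeries.hasseDeriv ℂ i) _ _
  map_smul' c f := by
    refine Laurent.ext fun n => ?_
    have key : ∀ g : Laurent, coeff n (LaurentSeries.hasseDeriv ℂ i (g : LaurentSeries ℂ) : Laurent)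
        = Ring.choose (n + (i : ℤ)) i • coeff (n + i) g := fun _ => rfl
    refine (key _).trans ?_
    rw [map_smul, smul_comm, ← key]
    exact ((coeff n).map_smul c _).symm

theorem coeff_hasseDeriv (i : ℕ) (f : Laurent) (n : ℤ) :
    coeff n (hasseDeriv i f) = ((Ring.choose (n + i) i : ℤ) : ℂ) * coeff (n + i) f := by
  rw [← zsmul_eq_mul]
  rfl

@[simp]
theorem hasseDeriv_zero (f : Laurent) : hasseDeriv 0 f = f := by
  ext n
  simp [coeff_hasseDeriv]

theorem cast_choose (n : ℤ) (i : ℕ) : ((Ring.choose n i : ℤ) : ℂ) = Ring.choose (n : ℂ) i :=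
  Ring.map_choose (Int.castRingHom ℂ) n i

theorem hasseDeriv_monomial (i : ℕ) (n : ℤ) :
    hasseDeriv i (monomial n) = Ring.choose (n : ℂ) i • monomial (n - i) := by
  ext m
  rw [coeff_hasseDeriv, map_smul, coeff_monomial, coeff_monomial, smul_eq_mul]
  by_cases h : m + i = n
  · rw [if_pos h, if_pos (by omega), h, cast_choose]
  · rw [if_neg h, if_neg (by omega), mul_zero, mul_zero]

end Laurent

open Laurent

/-- The Laurent series with no terms of degree less than `K`. -/
def laurentGE (K : ℤ) : Submodule ℂ Laurent where
  carrier := {f | ∀ n < K, coeff n f = 0}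
  zero_mem' := by intro n _; simp
  add_mem' := by
    intro f g hf hg n hn
    simp [hf n hn, hg n hn]
  smul_mem' := by
    intro c f hf n hn
    simp [hf n hn]

theorem laurentGE_anti {K L : ℤ} (h : K ≤ L) : laurentGE L ≤ laurentGE K :=
  fun _ hf n hn => hf n (hn.trans_le h)

theorem exists_mem_laurentGE (f : Laurent) : ∃ a, f ∈ laurentGE a :=
  ⟨HahnSeries.order (f : LaurentSeries ℂ), fun _ hn => HahnSeries.coeff_eq_zero_of_lt_order hn⟩

theorem mul_mem_laurentGE {K L : ℤ} {f g : Laurent} (hf : f ∈ laurentGE K)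
    (hg : g ∈ laurentGE L) : f * g ∈ laurentGE (K + L) := by
  intro n hn
  refine HahnSeries.coeff_mul.trans (sum_eq_zero fun ij hij => ?_)
  have hij := (Finset.mem_antidiagonal.1 hij).2.2
  by_cases h : ij.1 < K
  · exact (congrArg (· * _) (hf _ h)).trans (zero_mul _)
  · exact (congrArg (_ * ·) (hg _ (by omega))).trans (mul_zero _)

theorem hasseDeriv_mem_laurentGE {K : ℤ} {f : Laurent} (hf : f ∈ laurentGE K) (i : ℕ) :
    hasseDeriv i f ∈ laurentGE (K - i) := by
  intro n hn
  rw [coeff_hasseDeriv, hf _ (by omega), mul_zero]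

/-! ### Continuous linear maps on Laurent series. -/

/-- A linear map on Laurent series that vanishes on all series of sufficiently high order. -/
def IsLaurentContinuous {X : Type*} [AddCommGroup X] [Module ℂ X]
    (T : Laurent →ₗ[ℂ] X) : Prop :=
  ∃ K, ∀ f ∈ laurentGE K, T f = 0

namespace IsLaurentContinuous

variable {X X' : Type*} [AddCommGroup X] [Module ℂ X] [AddCommGroup X'] [Module ℂ X']
  {T T' : Laurent →ₗ[ℂ] X}

theorem sub (h : IsLaurentContinuous T) (h' : IsLaurentContinuous T') :
    IsLaurentContinuous (T - T') := by
  obtain ⟨K, hK⟩ := h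
  obtain ⟨L, hL⟩ := h'
  refine ⟨max K L, fun f hf => ?_⟩
  rw [LinearMap.sub_apply, hK f (laurentGE_anti (le_max_left _ _) hf),
    hL f (laurentGE_anti (le_max_right _ _) hf), sub_zero]

theorem smul (h : IsLaurentContinuous T) (c : ℂ) : IsLaurentContinuous (c • T) := by
  obtain ⟨K, hK⟩ := h
  exact ⟨K, fun f hf => by rw [LinearMap.smul_apply, hK f hf, smul_zero]⟩

theorem add (h : IsLaurentContinuous T) (h' : IsLaurentContinuous T') :
    IsLaurentContinuous (T + T') := by
  simpa [sub_eq_add_neg] using h.sub (h'.smul (-1))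

theorem sum {ι : Type*} (s : Finset ι) {S : ι → Laurent →ₗ[ℂ] X}
    (h : ∀ i, IsLaurentContinuous (S i)) : IsLaurentContinuous (∑ i ∈ s, S i) := by
  classical
  induction s using Finset.induction_on with
  | empty => exact ⟨0, fun f _ => by simp⟩
  | insert a s ha ih => rw [sum_insert ha]; exact (h a).add ih

theorem map (h : IsLaurentContinuous T) (B : X →ₗ[ℂ] X') : IsLaurentContinuous (B ∘ₗ T) := by
  obtain ⟨K, hK⟩ := h
  exact ⟨K, fun f hf => by rw [LinearMap.comp_apply, hK f hf, map_zero]⟩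

theorem comp_mulLeft (h : IsLaurentContinuous T) (g : Laurent) :
    IsLaurentContinuous (T ∘ₗ LinearMap.mulLeft ℂ g) := by
  obtain ⟨K, hK⟩ := h
  obtain ⟨a, ha⟩ := exists_mem_laurentGE g
  refine ⟨K - a, fun f hf => hK _ ?_⟩
  simpa using mul_mem_laurentGE ha hf

theorem comp_hasseDeriv (h : IsLaurentContinuous T) (i : ℕ) :
    IsLaurentContinuous (T ∘ₗ hasseDeriv i) := by
  obtain ⟨K, hK⟩ := h
  refine ⟨K + i, fun f hf => hK _ ?_⟩
  simpa using hasseDeriv_mem_laurentGE hf i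

/-- A continuous linear map is determined by its values on monomials. -/
theorem mem_of_monomials (h : IsLaurentContinuous T) (S : Submodule ℂ X) {a : ℤ}
    (hmon : ∀ m, a ≤ m → T (monomial m) ∈ S) {f : Laurent}
    (hf : f ∈ laurentGE a) : T f ∈ S := by
  obtain ⟨K, hK⟩ := h
  -- Leading terms are removed one at a time until the order reaches `K`, where `T` vanishes.
  have key : ∀ n : ℕ, (∀ f ∈ laurentGE (a + n), T f ∈ S) → ∀ f ∈ laurentGE a, T f ∈ S := by
    intro n
    induction n with
    | zero => intro h f hf; exact h f (by simpa using hf)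
    | succ n ih =>
      intro h
      refine ih fun f hf => ?_
      have h1 : f - coeff (a + n) f • monomial (a + n) ∈ laurentGE (a + (n + 1 : ℕ)) := by
        intro m hm
        rcases (show m < a + n ∨ m = a + n by push_cast at hm; omega) with hm' | rfl
        · simp [hf m hm', coeff_monomial_of_ne hm'.ne]
        · simp
      have h2 := S.add_mem (h _ h1) (S.smul_mem (coeff (a + n) f) (hmon (a + n) (by omega)))
      rwa [← map_smul, ← map_add, sub_add_cancel] at h2
  refine key (K - a).toNat (fun f hf => ?_) f hf
  rw [hK f (laurentGE_anti (by omega) hf)]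
  exact S.zero_mem

end IsLaurentContinuous

/-! ### The series $(1+z)^\alpha z^{-s}$ and their derivatives. -/

/-- The Laurent series `(1 + z)^α z^(-s)`. -/
def binom (α : ℂ) (s : ℤ) : Laurent :=
  monomial (-s) * ofPowerSeries (PowerSeries.binomialSeries ℂ α)

theorem coeff_binom_nat (α : ℂ) (s : ℤ) (n : ℕ) :
    coeff (n - s) (binom α s) = Ring.choose α n := by
  rw [binom, coeff_monomial_mul, sub_neg_eq_add, sub_add_cancel, coeff_ofPowerSeries_nat]
  simp

theorem binom_mem_laurentGE (α : ℂ) (s : ℤ) : binom α s ∈ laurentGE (-s) := by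
  intro n hn
  rw [binom, coeff_monomial_mul, coeff_ofPowerSeries_of_neg _ (by omega)]

theorem binom_zero (s : ℤ) : binom 0 s = monomial (-s) := by
  simp [binom]

theorem binom_mul (α β : ℂ) (s t : ℤ) : binom α s * binom β t = binom (α + β) (s + t) := by
  rw [binom, binom, binom, PowerSeries.binomialSeries_add, map_mul, neg_add,
    ← monomial_mul_monomial]
  ring

theorem monomial_mul_binom (n : ℤ) (α : ℂ) (s : ℤ) :
    monomial n * binom α s = binom α (s - n) := by
  rw [← neg_neg n, ← binom_zero, binom_mul, zero_add]
  congr 1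
  ring

/-- One factor $1+z$ is multiplied out. This exchange between the exponent and the pole order drives
all later reductions modulo $O(M)$. -/
theorem binom_add_one (α : ℂ) (s : ℤ) : binom (α + 1) s = binom α s + binom α (s - 1) := by
  have h : binom 1 0 = binom 0 0 + binom 0 (-1) := by
    rw [binom_zero, binom_zero, binom]
    have := PowerSeries.binomialSeries_nat (R := ℂ) (A := ℂ) 1
    rw [Nat.cast_one] at this
    rw [this]
    ext n
    rcases lt_or_ge n 0 with hn | hn
    · rw [coeff_monomial_mul, coeff_ofPowerSeries_of_neg _ (by omega), map_add,
        coeff_monomial_of_ne (by omega), coeff_monomial_of_ne (by omega), add_zero]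
    · lift n to ℕ using hn
      rw [coeff_monomial_mul, neg_zero, sub_zero, coeff_ofPowerSeries_nat, map_add,
        coeff_monomial, coeff_monomial]
      simp [PowerSeries.coeff_one, PowerSeries.coeff_X]
  have h2 := binom_mul α 1 s 0
  rw [h, mul_add, binom_mul, binom_mul] at h2
  simpa [sub_eq_add_neg] using h2.symm

theorem nat_mul_choose (α : ℂ) (n : ℕ) :
    ((n : ℂ) + 1) * Ring.choose α (n + 1) = (α - n) * Ring.choose α n := by
  have h := Ring.choose_smul_choose α (n := n + 1) (k := n) (by omega)
  simpa [Ring.choose_one_right, mul_comm] using h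

theorem nat_mul_choose' (α : ℂ) (n : ℕ) :
    ((n : ℂ) + 1) * Ring.choose α (n + 1) = α * Ring.choose (α - 1) n := by
  have h := Ring.choose_smul_choose α (n := n + 1) (k := 1) (by omega)
  simpa [Ring.choose_one_right] using h

theorem hasseDeriv_one_binom (α : ℂ) (s : ℤ) :
    hasseDeriv 1 (binom α s) = α • binom (α - 1) s - (s : ℂ) • binom α (s + 1) := by
  ext n
  rw [coeff_hasseDeriv, Ring.choose_one_right, map_sub, map_smul, map_smul, smul_eq_mul,
    smul_eq_mul, Nat.cast_one]
  rcases lt_trichotomy n (-s - 1) with h | rfl | h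
  · rw [binom_mem_laurentGE α s _ (by omega), binom_mem_laurentGE (α - 1) s _ (by omega),
      binom_mem_laurentGE α (s + 1) _ (by omega)]
    simp
  -- The lowest coefficient of the derivative, at $z^{-s-1}$, comes from $z^{-s}$ alone.
  · have h1 := coeff_binom_nat α s 0
    have h2 := coeff_binom_nat α (s + 1) 0
    rw [binom_mem_laurentGE (α - 1) s _ (by omega)]
    rw [show -s - 1 + 1 = ((0 : ℕ) : ℤ) - s by simp,
      show -s - 1 = ((0 : ℕ) : ℤ) - (s + 1) by push_cast; ring, h1, h2]
    simp
  · obtain ⟨k, rfl⟩ : ∃ k : ℕ, n = k - s := ⟨(n + s).toNat, by omega⟩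
    have h1 := coeff_binom_nat α s (k + 1)
    have h2 := coeff_binom_nat α (s + 1) (k + 1)
    have h3 := nat_mul_choose' α k
    rw [coeff_binom_nat, show (k : ℤ) - s + 1 = ((k + 1 : ℕ) : ℤ) - s by push_cast; ring, h1,
      show (k : ℤ) - s = ((k + 1 : ℕ) : ℤ) - (s + 1) by push_cast; ring, h2, ← h3]
    push_cast
    ring

theorem hasseDeriv_succ (i : ℕ) (f : Laurent) :
    hasseDeriv (i + 1) f = ((i : ℂ) + 1)⁻¹ • hasseDeriv 1 (hasseDeriv i f) := by
  ext n
  have h0 : ((i : ℂ) + 1) ≠ 0 := Nat.cast_add_one_ne_zero i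
  have h := nat_mul_choose ((n + i + 1 : ℤ) : ℂ) i
  rw [map_smul, coeff_hasseDeriv, coeff_hasseDeriv, coeff_hasseDeriv, smul_eq_mul,
    eq_inv_mul_iff_mul_eq₀ h0, cast_choose, cast_choose, cast_choose, Ring.choose_one_right,
    ← mul_assoc, ← mul_assoc, Nat.cast_add, Nat.cast_one, ← add_assoc, add_right_comm n 1, h]
  congr 2
  push_cast
  ring

theorem hasseDeriv_binom_zero (α : ℂ) (i : ℕ) :
    hasseDeriv i (binom α 0) = Ring.choose α i • binom (α - i) 0 := by
  induction i with
  | zero => simp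
  | succ i ih =>
    have h := nat_mul_choose α i
    have h0 : ((i : ℂ) + 1) ≠ 0 := Nat.cast_add_one_ne_zero i
    rw [hasseDeriv_succ, ih, map_smul, hasseDeriv_one_binom, Int.cast_zero, zero_smul,
      sub_zero, smul_smul, smul_smul, mul_assoc, mul_comm (Ring.choose α i), ← h,
      inv_mul_cancel_left₀ h0, Nat.cast_add, Nat.cast_one, sub_sub]

/-- A derivative of $(1+z)^\beta z^{-s}$ either lowers the exponent or deepens the pole; in the
second case $(1+z)^\beta=(1+z)^{\beta-1}(1+z)$ lowers the exponent as well. The coefficients are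
irrelevant later: only the common exponent and the bound $s\ge1$ are used. -/
theorem hasseDeriv_binom_one_mem (α : ℂ) (i : ℕ) :
    hasseDeriv i (binom α 1)
      ∈ Submodule.span ℂ {f | ∃ s : ℤ, 1 ≤ s ∧ f = binom (α - i) s} := by
  induction i with
  | zero => exact Submodule.subset_span ⟨1, le_refl _, by simp⟩
  | succ i ih =>
    rw [hasseDeriv_succ]
    refine Submodule.smul_mem _ _ ?_
    refine Submodule.span_induction (p := fun f _ => hasseDeriv 1 f ∈ _)
      ?_ (by simp) (fun x y _ _ hx hy => by rw [map_add]; exact Submodule.add_mem _ hx hy)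
      (fun c x _ hx => by rw [map_smul]; exact Submodule.smul_mem _ _ hx) ih
    rintro _ ⟨s, hs, rfl⟩
    have e : α - ((i + 1 : ℕ) : ℂ) = α - i - 1 := by push_cast; ring
    have h := binom_add_one (α - i - 1) (s + 1)
    rw [sub_add_cancel, add_sub_cancel_right] at h
    rw [hasseDeriv_one_binom, h, e]
    refine Submodule.sub_mem _ (Submodule.smul_mem _ _ (Submodule.subset_span ⟨s, hs, rfl⟩))
      (Submodule.smul_mem _ _ (Submodule.add_mem _ (Submodule.subset_span ⟨s + 1, by omega, rfl⟩)
        (Submodule.subset_span ⟨s, hs, rfl⟩)))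

/-! ### Residues against a test series, and the Jacobi identity for them. -/

section Residue

variable {V M : Type*} [AddCommGroup V] [Module ℂ V] [AddCommGroup M] [Module ℂ M]
  (Y : V →ₗ[ℂ] VertexOperator ℂ M)

/-- The bilinear map `(u, w) ↦ u_n w`. -/
def modeHom (n : ℤ) : V →ₗ[ℂ] M →ₗ[ℂ] M :=
  (LinearMap.proj n ∘ₗ VertexOperator.ncoeff) ∘ₗ Y

theorem modeHom_apply (n : ℤ) (u : V) (w : M) : modeHom Y n u w = mode Y n u w := rfl

theorem exists_mode_eq_zero (u : V) (w : M) : ∃ K : ℤ, ∀ n, K ≤ n → mode Y n u w = 0 :=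
  ⟨-HahnSeries.order ((HahnModule.of ℂ).symm (Y u w)), fun n hn =>
    VertexOperator.ncoeff_eq_zero_of_lt_order _ n w (by omega)⟩

theorem support_coeff_smul_mode_finite (f : Laurent) (u : V) (w : M) :
    (Function.support fun n : ℤ => coeff n f • mode Y n u w).Finite := by
  obtain ⟨a, ha⟩ := exists_mem_laurentGE f
  obtain ⟨K, hK⟩ := exists_mode_eq_zero Y u w
  refine (Set.finite_Ico a K).subset fun n hn => ?_
  rw [Function.mem_support] at hn
  constructor
  · by_contra h
    exact hn (by rw [ha n (not_le.1 h), zero_smul])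
  · by_contra h
    exact hn (by rw [hK n (not_lt.1 h), smul_zero])

/-- `Res_z f(z) Y(u, z) w`, for a Laurent series `f`. -/
def residue : Laurent →ₗ[ℂ] V →ₗ[ℂ] M →ₗ[ℂ] M :=
  LinearMap.mk₂ ℂ (fun f u =>
      ({ toFun := fun w => ∑ᶠ n : ℤ, coeff n f • mode Y n u w
         map_add' := fun w w' => by
          rw [← finsum_add_distrib (support_coeff_smul_mode_finite Y f u w)
            (support_coeff_smul_mode_finite Y f u w')]
          simp [← modeHom_apply]
         map_smul' := fun c w => by
          rw [RingHom.id_apply, smul_finsum' _ (support_coeff_smul_mode_finite Y f u w)]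
          simp [← modeHom_apply, smul_comm c] } : M →ₗ[ℂ] M))
    (fun f g u => LinearMap.ext fun w => by
      refine Eq.trans ?_ (finsum_add_distrib (support_coeff_smul_mode_finite Y f u w)
        (support_coeff_smul_mode_finite Y g u w))
      simp [add_smul])
    (fun c f u => LinearMap.ext fun w => by
      refine Eq.trans ?_ (smul_finsum' c (support_coeff_smul_mode_finite Y f u w)).symm
      simp [mul_smul])
    (fun f u v => LinearMap.ext fun w => by
      refine Eq.trans ?_ (finsum_add_distrib (support_coeff_smul_mode_finite Y f u w)
        (support_coeff_smul_mode_finite Y f v w))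
      simp [← modeHom_apply])
    (fun c f u => LinearMap.ext fun w => by
      refine Eq.trans ?_ (smul_finsum' c (support_coeff_smul_mode_finite Y f u w)).symm
      simp [← modeHom_apply, smul_comm c])

theorem residue_apply (f : Laurent) (u : V) (w : M) :
    residue Y f u w = ∑ᶠ n : ℤ, coeff n f • mode Y n u w := rfl

theorem residue_monomial (n : ℤ) (u : V) (w : M) :
    residue Y (monomial n) u w = mode Y n u w := by
  rw [residue_apply, finsum_eq_single _ n]
  · simp
  · intro m hm
    rw [coeff_monomial_of_ne hm, zero_smul]

theorem residue_eq_zero {u : V} {w : M} {K : ℤ} (hK : ∀ n, K ≤ n → mode Y n u w = 0)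
    {f : Laurent} (hf : f ∈ laurentGE K) : residue Y f u w = 0 := by
  rw [residue_apply, finsum_eq_zero_of_forall_eq_zero]
  intro n
  rcases lt_or_ge n K with h | h
  · rw [hf n h, zero_smul]
  · rw [hK n h, smul_zero]

/-- The linear map `f ↦ Res_z f(z) Y(u, z) w`. -/
def residueAt (u : V) (w : M) : Laurent →ₗ[ℂ] M := LinearMap.applyₗ w ∘ₗ (residue Y).flip u

@[simp]
theorem residueAt_apply (f : Laurent) (u : V) (w : M) : residueAt Y u w f = residue Y f u w := rfl

theorem isLaurentContinuous_residueAt (u : V) (w : M) : IsLaurentContinuous (residueAt Y u w) := by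
  obtain ⟨K, hK⟩ := exists_mode_eq_zero Y u w
  exact ⟨K, fun f hf => residue_eq_zero Y hK hf⟩

/-- A residue lies in every subspace that contains the relevant modes. -/
theorem residue_mem (S : Submodule ℂ M) {u : V} {w : M} {a : ℤ}
    (h : ∀ n, a ≤ n → mode Y n u w ∈ S) {f : Laurent} (hf : f ∈ laurentGE a) :
    residue Y f u w ∈ S :=
  (isLaurentContinuous_residueAt Y u w).mem_of_monomials S
    (fun m hm => by simpa [residue_monomial] using h m hm) hf

theorem exists_residue_binom_eq_sum (α : ℂ) (s : ℤ) (u : V) (w : M) :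
    ∃ I : ℕ, ∀ J ≥ I, residue Y (binom α s) u w
      = ∑ n ∈ range J, Ring.choose α n • mode Y (n - s) u w := by
  obtain ⟨K, hK⟩ := exists_mode_eq_zero Y u w
  refine ⟨(K + s).toNat, fun J hJ => ?_⟩
  have h : binom α s - ∑ n ∈ range J, Ring.choose α n • monomial ((n : ℤ) - s)
      ∈ laurentGE K := by
    intro m hm
    rw [map_sub, map_sum]
    simp only [map_smul, coeff_monomial, smul_eq_mul, mul_ite, mul_one, mul_zero]
    rcases lt_or_ge m (-s) with h | h
    · rw [binom_mem_laurentGE α s m h, sum_eq_zero, sub_zero]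
      intro n _
      rw [if_neg (by omega)]
    · obtain ⟨k, rfl⟩ : ∃ k : ℕ, m = k - s := ⟨(m + s).toNat, by omega⟩
      rw [coeff_binom_nat, sum_eq_single k, if_pos rfl, sub_self]
      · intro n _ hn
        rw [if_neg (by omega)]
      · intro hk
        rw [mem_range] at hk
        omega
  have h2 := residue_eq_zero Y hK h
  rw [← residueAt_apply, map_sub, map_sum, sub_eq_zero] at h2
  simpa [residue_monomial] using h2

theorem residue_binom_eq_finsum (α : ℂ) (s : ℤ) (u : V) (w : M) :
    residue Y (binom α s) u w = ∑ᶠ n : ℕ, Ring.choose α n • mode Y (n - s) u w := by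
  obtain ⟨I, hI⟩ := exists_residue_binom_eq_sum Y α s u w
  obtain ⟨K, hK⟩ := exists_mode_eq_zero Y u w
  rw [hI (max I (K + s).toNat) (le_max_left _ _), eq_comm]
  refine finsum_eq_sum_of_support_subset _ fun n hn => ?_
  rw [Function.mem_support] at hn
  rw [coe_range, Set.mem_Iio]
  by_contra h
  rw [not_lt, max_le_iff] at h
  exact hn (by rw [hK _ (by omega), smul_zero])

/-- The Jacobi identity paired with a Laurent series in each of the variables `x₁`, `x₂`. -/
theorem residue_jacobi {C : DGSpace V} {YV : V →ₗ[ℂ] VertexOperator ℂ V}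
    (hJ : JacobiIdentity C YV Y) {p q : ℤ} {u v : V} (hu : u ∈ C.deg p) (hv : v ∈ C.deg q)
    (l : ℤ) (f g : Laurent) (w : M) :
    ∃ I : ℕ, ∀ J ≥ I,
      ∑ i ∈ range J, ((-1 : ℂ) ^ i * Ring.choose (l : ℂ) i) •
        (residue Y (monomial (l - i) * f) u (residue Y (monomial i * g) v w)
          - ((-1 : ℂ) ^ l * (-1 : ℂ) ^ (p * q)) •
            residue Y (monomial (l - i) * g) v (residue Y (monomial i * f) u w))
      = ∑ i ∈ range J, residue Y (hasseDeriv i f * g) (mode YV (l + i) u v) w := by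
  obtain ⟨a, ha⟩ := exists_mem_laurentGE f
  obtain ⟨b, hb⟩ := exists_mem_laurentGE g
  obtain ⟨K₁, hK₁⟩ := exists_mode_eq_zero Y v w
  obtain ⟨K₂, hK₂⟩ := exists_mode_eq_zero Y u w
  obtain ⟨K₃, hK₃⟩ := exists_mode_eq_zero YV u v
  -- For $i$ beyond this bound $v_{n+i}w$, $u_{m+i}w$ and $u_{l+i}v$ vanish for all $m\ge a$, $n\ge
  -- b$. One cutoff thus serves all monomials, and both sides become finite sums of continuous maps.
  refine ⟨max (K₁ - b).toNat (max (K₂ - a).toNat (K₃ - l).toNat), fun J hJJ => ?_⟩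
  rw [ge_iff_le, max_le_iff, max_le_iff] at hJJ
  set ε : ℂ := (-1 : ℂ) ^ l * (-1 : ℂ) ^ (p * q)
  set c : ℕ → ℂ := fun i => (-1 : ℂ) ^ i * Ring.choose (l : ℂ) i
  have mono : ∀ m n : ℤ, a ≤ m → b ≤ n →
      ∑ i ∈ range J, c i •
        (residue Y (monomial (l - i) * monomial m) u (residue Y (monomial i * monomial n) v w)
          - ε • residue Y (monomial (l - i) * monomial n) v
              (residue Y (monomial i * monomial m) u w))
      = ∑ i ∈ range J,
          residue Y (hasseDeriv i (monomial m) * monomial n) (mode YV (l + i) u v) w := by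
    intro m n hm hn
    have h := hJ p q u hu v hv l m n w
    rw [finsum_eq_sum_of_support_subset (s := range J),
      finsum_eq_sum_of_support_subset (s := range J)] at h
    · convert h using 1
      · refine sum_congr rfl fun i _ => ?_
        simp only [monomial_mul_monomial, residue_monomial]
        rw [show l - i + m = m + l - i by ring, show l - i + n = n + l - i by ring,
          add_comm (i : ℤ) n, add_comm (i : ℤ) m]
      · refine sum_congr rfl fun i _ => ?_
        rw [hasseDeriv_monomial, smul_mul_assoc, map_smul, LinearMap.smul_apply,
          LinearMap.smul_apply, monomial_mul_monomial, residue_monomial,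
          show m - i + n = m + n - i by ring]
    · intro i hi
      rw [Function.mem_support] at hi
      rw [coe_range, Set.mem_Iio]
      by_contra h
      refine hi ?_
      rw [hK₃ _ (by omega), ← modeHom_apply, map_zero, LinearMap.zero_apply, smul_zero]
    · intro i hi
      rw [Function.mem_support] at hi
      rw [coe_range, Set.mem_Iio]
      by_contra h
      refine hi ?_
      rw [hK₁ _ (by omega), hK₂ _ (by omega), ← modeHom_apply, ← modeHom_apply, map_zero, map_zero,
        smul_zero, sub_zero, smul_zero]
  -- Continuity extends the identity from monomials to `g` first, and afterwards to `f`.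
  have step : ∀ m : ℤ, a ≤ m →
      ∑ i ∈ range J, c i •
        (residue Y (monomial (l - i) * monomial m) u (residue Y (monomial i * g) v w)
          - ε • residue Y (monomial (l - i) * g) v (residue Y (monomial i * monomial m) u w))
      = ∑ i ∈ range J, residue Y (hasseDeriv i (monomial m) * g) (mode YV (l + i) u v) w := by
    intro m hm
    let T : Laurent →ₗ[ℂ] M :=
      ∑ i ∈ range J, c i •
          (residue Y (monomial (l - i) * monomial m) u ∘ₗ
              (residueAt Y v w ∘ₗ LinearMap.mulLeft ℂ (monomial i))
            - ε • (residueAt Y v (residue Y (monomial i * monomial m) u w) ∘ₗ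
                LinearMap.mulLeft ℂ (monomial (l - i))))
        - ∑ i ∈ range J, residueAt Y (mode YV (l + i) u v) w ∘ₗ
            LinearMap.mulLeft ℂ (hasseDeriv i (monomial m))
    have hT : IsLaurentContinuous T :=
      (IsLaurentContinuous.sum _ fun i =>
        ((((isLaurentContinuous_residueAt Y v w).comp_mulLeft _).map _).sub
          (((isLaurentContinuous_residueAt Y v _).comp_mulLeft _).smul _)).smul _).sub
      (IsLaurentContinuous.sum _ fun i => (isLaurentContinuous_residueAt Y _ w).comp_mulLeft _)
    have h := hT.mem_of_monomials ⊥ (a := b) (fun n hn => by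
      simpa [T, LinearMap.sum_apply, sub_eq_zero] using mono m n hm hn) hb
    simpa [T, LinearMap.sum_apply, sub_eq_zero] using h
  let T : Laurent →ₗ[ℂ] M :=
    ∑ i ∈ range J, c i •
        (residueAt Y u (residue Y (monomial i * g) v w) ∘ₗ LinearMap.mulLeft ℂ (monomial (l - i))
          - ε • (residue Y (monomial (l - i) * g) v ∘ₗ
              (residueAt Y u w ∘ₗ LinearMap.mulLeft ℂ (monomial i))))
      - ∑ i ∈ range J, (residueAt Y (mode YV (l + i) u v) w ∘ₗ LinearMap.mulLeft ℂ g) ∘ₗ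
          hasseDeriv i
  have hT : IsLaurentContinuous T :=
    (IsLaurentContinuous.sum _ fun i =>
      (((isLaurentContinuous_residueAt Y u _).comp_mulLeft _).sub
        ((((isLaurentContinuous_residueAt Y u w).comp_mulLeft _).map _).smul _)).smul _).sub
    (IsLaurentContinuous.sum _ fun i =>
      ((isLaurentContinuous_residueAt Y _ w).comp_mulLeft _).comp_hasseDeriv _)
  have h := hT.mem_of_monomials ⊥ (a := a) (fun m hm => by
    simpa [T, LinearMap.sum_apply, sub_eq_zero, mul_comm g] using step m hm) ha
  simpa [T, LinearMap.sum_apply, sub_eq_zero, mul_comm g] using h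

end Residue

/-! ### Linear maps defined on the summands of a direct sum. -/

section Glue

variable {ι X X' : Type*} [DecidableEq ι] [AddCommGroup X] [Module ℂ X] [AddCommGroup X']
  [Module ℂ X'] {W : ι → Submodule ℂ X}

/-- Linear maps on the summands of a direct sum extend to the whole space. -/
theorem exists_linearMap_of_isInternal (h : DirectSum.IsInternal W) (φ : ι → X →ₗ[ℂ] X') :
    ∃ Φ : X →ₗ[ℂ] X', ∀ i, ∀ x ∈ W i, Φ x = φ i x := by
  let e := LinearEquiv.ofBijective (DirectSum.coeLinearMap W) h
  refine ⟨DirectSum.toModule ℂ ι X' (fun i => φ i ∘ₗ (W i).subtype) ∘ₗ e.symm.toLinearMap,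
    fun i x hx => ?_⟩
  have he : e.symm x = DirectSum.lof ℂ ι (fun i => W i) i ⟨x, hx⟩ := by
    rw [LinearEquiv.symm_apply_eq]
    exact (DirectSum.coeLinearMap_lof W i ⟨x, hx⟩).symm
  simp [he]

/-- The linear map on a direct sum with given restrictions to the summands. -/
def glue (h : DirectSum.IsInternal W) (φ : ι → X →ₗ[ℂ] X') : X →ₗ[ℂ] X' :=
  (exists_linearMap_of_isInternal h φ).choose

theorem glue_apply (h : DirectSum.IsInternal W) (φ : ι → X →ₗ[ℂ] X') {i : ι} {x : X}
    (hx : x ∈ W i) : glue h φ x = φ i x :=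
  (exists_linearMap_of_isInternal h φ).choose_spec i x hx

theorem internal_induction (h : DirectSum.IsInternal W) {P : X → Prop}
    (zero : P 0) (mem : ∀ i, ∀ x ∈ W i, P x) (add : ∀ x y, P x → P y → P (x + y)) (x : X) :
    P x := by
  have hx : x ∈ ⨆ i, W i := by rw [h.submodule_iSup_eq_top]; trivial
  exact Submodule.iSup_induction W (motive := P) hx mem zero add

end Glue

/-! ### The translation property. -/

section Modes

variable {V M : Type*} [AddCommGroup V] [Module ℂ V] [AddCommGroup M] [Module ℂ M]

theorem DGSpace.induction (C : DGSpace V) {P : V → Prop} (zero : P 0)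
    (mem : ∀ p, ∀ x ∈ C.deg p, P x) (add : ∀ x y, P x → P y → P (x + y)) (x : V) : P x :=
  internal_induction C.deg_internal zero mem add x

/-- `Res_z Y(u, z) (1 + z)^α z^(-s) m`, as a bilinear map. -/
def DGModule.bres {A : DGVertexAlgebra V} (N : DGModule A M) (α : ℂ) (s : ℤ) :
    V →ₗ[ℂ] M →ₗ[ℂ] M :=
  residue N.Y (binom α s)

theorem DGModule.res_eq_bres {A : DGVertexAlgebra V} (N : DGModule A M) (α : ℂ) (s : ℤ) (u : V)
    (m : M) : N.res α s u m = N.bres α s u m :=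
  (residue_binom_eq_finsum N.Y α s u m).symm

theorem DGModule.bres_add_one {A : DGVertexAlgebra V} (N : DGModule A M) (α : ℂ) (s : ℤ) (u : V)
    (m : M) : N.bres (α + 1) s u m = N.bres α s u m + N.bres α (s - 1) u m := by
  simp [DGModule.bres, binom_add_one]

theorem DGModule.mode_translation {A : DGVertexAlgebra V} (N : DGModule A M) (n : ℤ) (u : V)
    (w : M) :
    mode N.Y n (mode A.Y (-2) u A.vac) w = -(n : ℂ) • mode N.Y (n - 1) u w := by
  revert u
  refine A.toDGSpace.induction ?_ ?_ ?_
  · simp [← modeHom_apply]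
  · intro p u hu
    -- With $v=\mathbf 1$ and these indices only vacuum modes of index other than $-1$ occur on the
    -- left, so the left side is zero. On the right only $u_{-2}\mathbf 1$ and $u_{-1}\mathbf 1=u$
    -- remain.
    have h := N.jacobi p 0 u hu A.vac A.vac_mem (-2) n 0 w
    rw [finsum_eq_zero_of_forall_eq_zero, finsum_eq_sum_of_support_subset (s := range 2)] at h
    · rw [sum_range_succ, sum_range_one] at h
      simp only [Nat.cast_zero, Nat.cast_one, add_zero, sub_zero, Ring.choose_zero_right,
        Ring.choose_one_right, one_smul] at h
      rw [show (-2 : ℤ) + 1 = -1 by norm_num, A.creation] at h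
      rw [neg_smul]
      exact eq_neg_of_add_eq_zero_left h.symm
    · intro i hi
      rw [Function.mem_support] at hi
      rw [coe_range, Set.mem_Iio]
      by_contra h
      refine hi ?_
      rw [A.creation_nonneg _ _ (by omega), ← modeHom_apply, map_zero, LinearMap.zero_apply,
        smul_zero]
    · intro i
      rw [N.vac_mode, N.vac_mode, if_neg (by omega), if_neg (by omega), ← modeHom_apply, map_zero,
        smul_zero, sub_zero, smul_zero]
  · intro x y hx hy
    simp only [← modeHom_apply, map_add, LinearMap.add_apply, smul_add] at hx hy ⊢
    rw [hx, hy]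

theorem DGModule.residue_translation {A : DGVertexAlgebra V} (N : DGModule A M) (f : Laurent)
    (u : V) (w : M) :
    residue N.Y f (mode A.Y (-2) u A.vac) w = -residue N.Y (hasseDeriv 1 f) u w := by
  obtain ⟨a, ha⟩ := exists_mem_laurentGE f
  let T : Laurent →ₗ[ℂ] M :=
    residueAt N.Y (mode A.Y (-2) u A.vac) w + residueAt N.Y u w ∘ₗ hasseDeriv 1
  have hT : IsLaurentContinuous T :=
    (isLaurentContinuous_residueAt _ _ _).add
      ((isLaurentContinuous_residueAt _ _ _).comp_hasseDeriv _)
  have h := hT.mem_of_monomials ⊥ (a := a) (fun m _ => by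
    simp [T, hasseDeriv_monomial, residue_monomial, N.mode_translation]) ha
  rw [Submodule.mem_bot] at h
  exact eq_neg_of_add_eq_zero_left h

end Modes

/-! ### Weights, membership in $O(M)$, commutator and iterate formulas. -/

section Weights

variable {V M : Type*} [AddCommGroup V] [Module ℂ V] [AddCommGroup M] [Module ℂ M] (A : DGVOA V)

theorem DGVOA.mem_weight {k : ℤ} {u : V} :
    u ∈ A.weight k ↔ mode A.Y 1 A.ω u = ((k : ℂ) / 2) • u := by
  rw [DGVOA.weight, DGVertexAlgebra.halfWeightSpace, Module.End.mem_eigenspace_iff]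
  rfl

theorem DGVOA.mode_omega_zero (u : V) : mode A.Y 0 A.ω u = mode A.Y (-2) u A.vac :=
  A.virasoro_neg_one u

/-- This is $[L(0),u_n]=(L(0)u)_n+(L(-1)u)_{n+1}$ with the last term evaluated by translation. No
sign appears, as $\omega$ has even degree. -/
theorem DGVOA.mode_omega_one_comm (n : ℤ) (u w : V) :
    mode A.Y 1 A.ω (mode A.Y n u w) = mode A.Y n u (mode A.Y 1 A.ω w)
      + (mode A.Y n (mode A.Y 1 A.ω u) w - ((n : ℂ) + 1) • mode A.Y n u w) := by
  revert u
  refine A.toDGSpace.induction ?_ ?_ ?_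
  · simp [← modeHom_apply]
  · intro p u hu
    have h := A.jacobi 4 p A.ω A.ω_mem u hu 0 1 n w
    rw [finsum_eq_single _ 0, finsum_eq_sum_of_support_subset (s := range 2)] at h
    · rw [sum_range_succ, sum_range_one] at h
      simp only [Nat.cast_zero, Nat.cast_one, add_zero, sub_zero, Ring.choose_zero_right,
        Ring.choose_one_right, one_smul, pow_zero, zpow_zero, one_mul, Int.cast_one, zero_add,
        add_sub_cancel_left] at h
      have hT : mode A.Y (1 + n) (mode A.Y (-2) u A.vac) w = _ :=
        A.adjoint.mode_translation (1 + n) u w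
      rw [A.mode_omega_zero, hT, zpow_mul] at h
      norm_num at h
      rw [sub_eq_iff_eq_add] at h
      rw [h, add_comm (n : ℂ) 1]
      simp only [DGVertexAlgebra.adjoint]
      module
    · intro i hi
      rw [Function.mem_support] at hi
      rw [coe_range, Set.mem_Iio]
      by_contra h
      refine hi ?_
      have hc : Ring.choose ((1 : ℤ) : ℂ) i = 0 := by
        rw [← cast_choose, ← Nat.cast_one, Ring.choose_natCast, Nat.choose_eq_zero_of_lt (by omega)]
        simp
      rw [hc, zero_smul]
    · intro i hi
      rw [Int.cast_zero, Ring.choose_zero_pos ℂ (Nat.pos_of_ne_zero hi), mul_zero, zero_smul]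
  · intro x y hx hy
    simp only [← modeHom_apply, map_add, LinearMap.add_apply, smul_add] at hx hy ⊢
    rw [hx, hy]
    abel

theorem DGVOA.mode_mem_weight {k k' : ℤ} {u v : V} (hu : u ∈ A.weight k) (hv : v ∈ A.weight k')
    (n : ℤ) : mode A.Y n u v ∈ A.weight (k + k' - 2 * n - 2) := by
  rw [DGVOA.mem_weight] at hu hv ⊢
  rw [A.mode_omega_one_comm, hu, hv]
  simp only [← modeHom_apply, map_smul, LinearMap.smul_apply]
  push_cast
  module

theorem DGVOA.vac_mem_weight : A.vac ∈ A.weight 0 := by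
  rw [DGVOA.mem_weight, A.creation_nonneg _ _ zero_le_one]
  simp

variable {A} (N : WeakDGModule A M)

theorem bres_two_mem_zhuO {k : ℤ} {u : V} (hu : u ∈ A.weight k) (m : M) :
    N.bres ((k : ℂ) / 2) 2 u m ∈ zhuO A N :=
  Submodule.subset_span ⟨k, u, hu, m, (N.res_eq_bres _ _ _ _).symm⟩

/-- `Res_z Y(u, z) (1 + z)^(wt u + n) z^(-s) m` lies in `O(M)` for `s ≥ n + 2`. -/
theorem bres_mem_zhuO {k : ℤ} {u : V} (hu : u ∈ A.weight k) (m : M) (n : ℕ) {α : ℂ}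
    (hα : α = (k : ℂ) / 2 + n) {s : ℤ} (hs : n + 2 ≤ s) : N.bres α s u m ∈ zhuO A N := by
  have base : ∀ j : ℕ, ∀ (k : ℤ) (u : V), u ∈ A.weight k →
      N.bres ((k : ℂ) / 2) (j + 2) u m ∈ zhuO A N := by
    intro j
    induction j with
    | zero => intro k u hu; simpa using bres_two_mem_zhuO N hu m
    | succ j ih =>
      intro k u hu
      -- The induction hypothesis is applied to $L(-1)u$, of weight $\mathrm{wt}\,u+1$.
      -- Differentiating its test series produces the pole of order $j+3$ with coefficient
      -- $j+2\ne0$, plus a multiple of the pole of order $j+2$.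
      have hT := ih _ _ (A.mode_mem_weight hu A.vac_mem_weight (-2))
      have e : ((k + 0 - 2 * (-2) - 2 : ℤ) : ℂ) / 2 = (k : ℂ) / 2 + 1 := by push_cast; ring
      rw [e, DGModule.bres, N.residue_translation, hasseDeriv_one_binom] at hT
      simp only [map_sub, map_smul, LinearMap.sub_apply, LinearMap.smul_apply,
        add_sub_cancel_right] at hT
      change -(((k : ℂ) / 2 + 1) • N.bres ((k : ℂ) / 2) (j + 2) u m
        - _ • N.bres ((k : ℂ) / 2 + 1) (j + 2 + 1) u m) ∈ _ at hT
      rw [N.bres_add_one, add_sub_cancel_right] at hT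
      have h1 := ih k u hu
      have h2 : (((j + 2 : ℤ) : ℂ)) • N.bres ((k : ℂ) / 2) (j + 2 + 1) u m ∈ zhuO A N := by
        have h3 := Submodule.add_mem _ hT
          (Submodule.smul_mem _ ((k : ℂ) / 2 + 1 - ((j + 2 : ℤ) : ℂ)) h1)
        convert h3 using 1
        module
      rw [Submodule.smul_mem_iff _ (Int.cast_ne_zero.2 (by omega))] at h2
      rwa [show ((j + 1 : ℕ) : ℤ) + 2 = j + 2 + 1 by push_cast; ring]
  subst hα
  induction n generalizing s with
  | zero =>
    have h := base (s - 2).toNat k u hu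
    rw [show ((s - 2).toNat : ℤ) + 2 = s by omega] at h
    simpa using h
  | succ n ih =>
    -- Each extra factor $1+z$ costs at most one order of pole.
    rw [Nat.cast_add, Nat.cast_one, ← add_assoc, N.bres_add_one]
    push_cast at hs
    exact Submodule.add_mem _ (ih (by omega)) (ih (by omega))

/-- The supercommutator is a sum of residues of $u_iv$, of weight
$\mathrm{wt}\,u+\mathrm{wt}\,v-i-1$. The $i$-th derivative lowers the exponent by $i$ too, so the
excess over the weight is always $n$, and the pole has order at least $1+t\ge n+2$. -/
theorem bres_comm_mem_zhuO {p q k k' : ℤ} {u v : V} (hup : u ∈ A.deg p) (huk : u ∈ A.weight k)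
    (hvq : v ∈ A.deg q) (hvk : v ∈ A.weight k') (n : ℕ) {α β : ℂ} {t : ℤ}
    (hαβ : α + β = (k : ℂ) / 2 + (k' : ℂ) / 2 - 1 + n) (ht : n + 1 ≤ t) (w : M) :
    N.bres α 1 u (N.bres β t v w) - (-1 : ℂ) ^ (p * q) • N.bres β t v (N.bres α 1 u w)
      ∈ zhuO A N := by
  obtain ⟨I, hI⟩ := residue_jacobi N.Y N.jacobi hup hvq 0 (binom α 1) (binom β t) w
  -- For $l=0$ only the term $i=0$ survives on the left; the cutoff `I + 1` ensures that it is
  -- present.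
  have h := hI (I + 1) (by omega)
  rw [sum_range_succ', sum_eq_zero] at h
  · simp only [pow_zero, Int.cast_zero, Ring.choose_zero_right, mul_one, one_smul, zero_add,
      CharP.cast_eq_zero, sub_zero, monomial_zero, one_mul, zpow_zero] at h
    rw [DGModule.bres, DGModule.bres, h]
    refine Submodule.sum_mem _ fun i _ => ?_
    refine Submodule.span_induction
      (p := fun f _ => residue N.Y (f * binom β t) (mode A.Y i u v) w ∈ zhuO A N)
      ?_ (by simp) (fun x y _ _ hx hy => ?_) (fun c x _ hx => ?_) (hasseDeriv_binom_one_mem α i)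
    · rintro _ ⟨s, hs, rfl⟩
      rw [binom_mul]
      refine bres_mem_zhuO N (A.mode_mem_weight huk hvk i) w n ?_ (by omega)
      rw [sub_add_eq_add_sub, hαβ]
      push_cast
      ring
    · rw [add_mul, map_add]
      exact Submodule.add_mem _ hx hy
    · rw [smul_mul_assoc, map_smul]
      exact Submodule.smul_mem _ _ hx
  · intro i _
    rw [Int.cast_zero, Ring.choose_zero_pos ℂ (Nat.succ_pos i), mul_zero, zero_smul]

variable (A) in
theorem isInternal_weight : DirectSum.IsInternal A.weight := A.weight_internal

/-- The bilinear map `(u, m) ↦ Res_z Y(u, z) (1 + z)^(wt u + c) z^(-s) m`. -/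
def zhuOp (c : ℂ) (s : ℤ) : V →ₗ[ℂ] M →ₗ[ℂ] M :=
  glue (isInternal_weight A) fun k => N.bres ((k : ℂ) / 2 + c) s

theorem zhuOp_apply (c : ℂ) (s : ℤ) {k : ℤ} {u : V} (hu : u ∈ A.weight k) :
    zhuOp N c s u = N.bres ((k : ℂ) / 2 + c) s u :=
  glue_apply _ _ hu

/-- The iterate formula for `(1 + z)^(wt u) z^(-s)`. -/
theorem zhuOp_bres {p q k k' : ℤ} {u v : V} (hup : u ∈ A.deg p) (huk : u ∈ A.weight k)
    (hvq : v ∈ A.deg q) (hvk : v ∈ A.weight k') (c : ℂ) (s : ℤ) {β : ℂ}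
    (hβ : β = (k' : ℂ) / 2 + s - 1 + c) (w : M) :
    ∃ I : ℕ, ∀ J ≥ I, zhuOp N c 1 (A.adjoint.bres ((k : ℂ) / 2) s u v) w
      = ∑ i ∈ range J, ((-1 : ℂ) ^ i * Ring.choose (-s : ℂ) i) •
          (N.bres ((k : ℂ) / 2) (s + i) u (N.bres β (1 - i) v w)
            - ((-1 : ℂ) ^ (-s) * (-1 : ℂ) ^ (p * q)) •
              N.bres β (1 + s + i) v (N.bres ((k : ℂ) / 2) (-i) u w)) := by
  -- The exponent $l=-s$ produces the pole in $x_0$. The $i$-th derivative of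
  -- $(1+x_1)^{\mathrm{wt}\,u}$ supplies the coefficient $\binom{\mathrm{wt}\,u}{i}$ of $u_{i-s}v$
  -- in the inner residue.
  obtain ⟨I, hI⟩ :=
    residue_jacobi N.Y N.jacobi hup hvq (-s) (binom ((k : ℂ) / 2) 0) (binom β 1) w
  obtain ⟨I', hI'⟩ := exists_residue_binom_eq_sum A.Y ((k : ℂ) / 2) s u v
  refine ⟨max I I', fun J hJ => ?_⟩
  rw [ge_iff_le, max_le_iff] at hJ
  have h := hI J hJ.1
  simp only [monomial_mul_binom, hasseDeriv_binom_zero, smul_mul_assoc, binom_mul, map_smul,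
    LinearMap.smul_apply] at h
  have e : A.adjoint.bres ((k : ℂ) / 2) s u v
      = ∑ n ∈ range J, Ring.choose ((k : ℂ) / 2) n • mode A.Y (n - s) u v := hI' J hJ.2
  rw [e, map_sum, LinearMap.sum_apply]
  refine Eq.trans (sum_congr rfl fun i _ => ?_) (h.symm.trans (sum_congr rfl fun i _ => ?_))
  -- The weight of $u_{i-s}v$ also falls by one with each $i$; this is what fixes `β`.
  · have e' : ((k + k' - 2 * (i - s) - 2 : ℤ) : ℂ) / 2 + c = (k : ℂ) / 2 - i + β := by
      rw [hβ]
      push_cast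
      ring
    rw [map_smul, LinearMap.smul_apply, zhuOp_apply N c 1 (A.mode_mem_weight huk hvk (i - s)),
      DGModule.bres, neg_add_eq_sub, zero_add, e']
  · rw [Int.cast_neg, show (0 : ℤ) - (-s - i) = s + i by ring, zero_sub,
      show (1 : ℤ) - (-s - i) = 1 + s + i by ring]
    rfl

end Weights

/-! ### Reduction to vectors homogeneous in degree and weight. -/

section Homogeneous

variable {V M : Type*} [AddCommGroup V] [Module ℂ V] [AddCommGroup M] [Module ℂ M] (A : DGVOA V)

/-- Induction on vectors of degree `p`, from those that are also weight homogeneous. -/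
theorem DGVOA.deg_induction {p : ℤ} {P : V → Prop} (zero : P 0)
    (mem : ∀ k, ∀ x ∈ A.deg p, x ∈ A.weight k → P x) (add : ∀ x y, P x → P y → P (x + y))
    {w : V} (hw : w ∈ A.deg p) : P w := by
  let π : V →ₗ[ℂ] V := glue A.deg_internal fun q => if q = p then LinearMap.id else 0
  have π_self : ∀ x ∈ A.deg p, π x = x := fun x hx => by simp [π, glue_apply _ _ hx]
  have π_ne : ∀ q, q ≠ p → ∀ x ∈ A.deg q, π x = 0 := fun q hq x hx => by
    simp [π, glue_apply _ _ hx, hq]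
  have π_mem : ∀ x, π x ∈ A.deg p := by
    refine A.toDGSpace.induction (by simp) (fun q x hx => ?_)
      (fun x y hx hy => by rw [map_add]; exact Submodule.add_mem _ hx hy)
    by_cases h : q = p
    · subst h
      rwa [π_self x hx]
    · rw [π_ne q h x hx]
      exact Submodule.zero_mem _
  -- $L(0)=\omega_1$ has degree $4-2-2=0$, so the projection onto degree $p$ preserves its
  -- eigenspaces.
  have π_comm : ∀ x, mode A.Y 1 A.ω (π x) = π (mode A.Y 1 A.ω x) := by
    simp only [← modeHom_apply]
    refine A.toDGSpace.induction (by simp) (fun q x hx => ?_)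
      (fun x y hx hy => by simp only [map_add, hx, hy])
    have hω : modeHom A.Y 1 A.ω x ∈ A.deg q := by
      have h := A.chain.mode_mem 4 q 1 A.ω A.ω_mem x hx
      rwa [show 4 + q - 2 * 1 - 2 = q by ring] at h
    by_cases h : q = p
    · subst h
      rw [π_self x hx, π_self _ hω]
    · rw [π_ne q h x hx, π_ne q h _ hω, map_zero]
  have key : ∀ x, π x ∈ ⨆ k, A.weight k ⊓ A.deg p := by
    refine internal_induction (isInternal_weight A) (by simp) (fun k x hx => ?_)
      (fun x y hx hy => by rw [map_add]; exact Submodule.add_mem _ hx hy)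
    refine Submodule.mem_iSup_of_mem k ⟨?_, π_mem x⟩
    rw [SetLike.mem_coe, DGVOA.mem_weight] at *
    rw [π_comm, hx, map_smul]
  have h := key w
  rw [π_self w hw] at h
  exact Submodule.iSup_induction _ (motive := P) h (fun k x hx => mem k x hx.2 hx.1) zero add

/-- Induction from vectors that are homogeneous for both the degree and the weight. -/
theorem DGVOA.bihomogeneous_induction {P : V → Prop} (zero : P 0)
    (mem : ∀ p k, ∀ x ∈ A.deg p, x ∈ A.weight k → P x) (add : ∀ x y, P x → P y → P (x + y))
    (x : V) : P x :=
  A.toDGSpace.induction zero (fun p _ hx => A.deg_induction zero (mem p) add hx) add x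

variable {A} (N : WeakDGModule A M)

/-- `O(M)` is spanned by the elements `u ∘ m` with `u` and `m` in given spanning sets. -/
theorem zhuO_le {S : Submodule ℂ M} {Q : M → Prop}
    (hQ : ∀ P : M → Prop, P 0 → (∀ x, Q x → P x) → (∀ x y, P x → P y → P (x + y)) → ∀ x, P x)
    (h : ∀ p k, ∀ u ∈ A.deg p, u ∈ A.weight k → ∀ m, Q m → N.bres ((k : ℂ) / 2) 2 u m ∈ S) :
    zhuO A N ≤ S := by
  -- The predicate `Q` is left open because `M` carries only a degree, whereas on `V` both gradings
  -- are needed.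
  have key : ∀ u m, zhuOp N 0 2 u m ∈ S := by
    refine A.bihomogeneous_induction (by simp) (fun p k u hu hk => ?_)
      (fun x y hx hy m => by
        rw [map_add, LinearMap.add_apply]; exact Submodule.add_mem _ (hx m) (hy m))
    refine hQ _ (by simp) (fun m hm => ?_)
      (fun x y hx hy => by rw [map_add]; exact Submodule.add_mem _ hx hy)
    rw [zhuOp_apply N 0 2 hk, add_zero]
    exact h p k u hu hk m hm
  refine Submodule.span_le.2 ?_
  rintro _ ⟨k, u, hu, m, rfl⟩
  have h := key u m
  rwa [zhuOp_apply N 0 2 hu, add_zero, ← N.res_eq_bres] at h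

theorem zhuO_le_of_homogeneous {S : Submodule ℂ M}
    (h : ∀ p k, ∀ u ∈ A.deg p, u ∈ A.weight k → ∀ q, ∀ m ∈ N.deg q,
      N.bres ((k : ℂ) / 2) 2 u m ∈ S) : zhuO A N ≤ S :=
  zhuO_le N (Q := fun m => ∃ q, m ∈ N.deg q)
    (fun _ zero mem add => N.toDGSpace.induction zero (fun q x hx => mem x ⟨q, hx⟩) add)
    (fun p k u hu hk m ⟨q, hm⟩ => h p k u hu hk q m hm)

theorem zhuO_adjoint_le {S : Submodule ℂ V}
    (h : ∀ p k, ∀ u ∈ A.deg p, u ∈ A.weight k → ∀ q k', ∀ v ∈ A.deg q, v ∈ A.weight k' →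
      A.adjoint.bres ((k : ℂ) / 2) 2 u v ∈ S) : zhuO A A.adjoint ≤ S :=
  zhuO_le A.adjoint (Q := fun v => ∃ q k, v ∈ A.deg q ∧ v ∈ A.weight k)
    (fun _ zero mem add =>
      A.bihomogeneous_induction zero (fun q k x hx hk => mem x ⟨q, k, hx, hk⟩) add)
    (fun p k u hu hk v ⟨q, k', hv, hk'⟩ => h p k u hu hk q k' v hv hk')

end Homogeneous

/-! ### The actions of $u\circ v$ and $u\ast v$ modulo $O(M)$. -/

section Congruences

variable {V M : Type*} [AddCommGroup V] [Module ℂ V] [AddCommGroup M] [Module ℂ M] {A : DGVOA V}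
  (N : WeakDGModule A M) {p q k k' : ℤ} {u v : V}

/-- In the iterate formula with $s=2$ the outer residues have poles of order at least $2$ in $u$ and
$3$ in $v$, enough for exponents $\mathrm{wt}\,u$ and $\mathrm{wt}\,v+n$. The case $n=1$ serves the
left action, $n=0$ the right one. -/
theorem zhuOp_circ_mem_zhuO (hup : u ∈ A.deg p) (huk : u ∈ A.weight k) (hvq : v ∈ A.deg q)
    (hvk : v ∈ A.weight k') {n : ℕ} (hn : n ≤ 1) {c : ℂ} (hc : c = n - 1) (w : M) :
    zhuOp N c 1 (A.adjoint.bres ((k : ℂ) / 2) 2 u v) w ∈ zhuO A N := by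
  obtain ⟨I, hI⟩ := zhuOp_bres N hup huk hvq hvk c 2 rfl w
  rw [hI I le_rfl]
  refine Submodule.sum_mem _ fun i _ => Submodule.smul_mem _ _ (Submodule.sub_mem _ ?_
    (Submodule.smul_mem _ _ ?_))
  · exact bres_mem_zhuO N huk _ 0 (by simp) (by omega)
  · refine bres_mem_zhuO N hvk _ n ?_ (by omega)
    rw [hc]
    push_cast
    ring

theorem neg_one_pow_mul_choose (i : ℕ) :
    (-1 : ℂ) ^ i * Ring.choose (-((1 : ℤ) : ℂ)) i = 1 := by
  rw [Ring.choose_neg, Int.cast_one, add_sub_cancel_left, Ring.choose_natCast, Nat.choose_self,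
    Nat.cast_one]
  rcases Nat.even_or_odd i with h | h
  · simp [h.neg_one_pow, Int.negOnePow_even i (by exact_mod_cast h)]
  · simp [h.neg_one_pow, Int.negOnePow_odd i (by exact_mod_cast h)]

/-- For $s=1$ every term with $v$ outside has pole order at least $2$, and among those with $u$
outside only $i=0$ has a simple pole. -/
theorem zhuOp_star_sub_mem_zhuO (hup : u ∈ A.deg p) (huk : u ∈ A.weight k) (hvq : v ∈ A.deg q)
    (hvk : v ∈ A.weight k') (w : M) :
    zhuOp N 0 1 (A.adjoint.bres ((k : ℂ) / 2) 1 u v) w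
      - N.bres ((k : ℂ) / 2) 1 u (N.bres ((k' : ℂ) / 2) 1 v w) ∈ zhuO A N := by
  obtain ⟨I, hI⟩ := zhuOp_bres N hup huk hvq hvk 0 1 (β := (k' : ℂ) / 2)
    (by push_cast; ring) w
  have hv : ∀ (i : ℕ) (x : M), N.bres ((k' : ℂ) / 2) (1 + 1 + i) v x ∈ zhuO A N := fun i x =>
    bres_mem_zhuO N hvk _ 0 (by simp) (by omega)
  rw [hI (I + 1) (by omega), sum_range_succ', add_sub_assoc]
  refine Submodule.add_mem _ (Submodule.sum_mem _ fun i _ => Submodule.smul_mem _ _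
    (Submodule.sub_mem _ ?_ (Submodule.smul_mem _ _ (hv _ _)))) ?_
  · exact bres_mem_zhuO N huk _ 0 (by simp) (by push_cast; omega)
  · rw [neg_one_pow_mul_choose, one_smul, Nat.cast_zero, add_zero, sub_zero, sub_sub_cancel_left]
    refine Submodule.neg_mem _ (Submodule.smul_mem _ _ ?_)
    simpa using hv 0 _

/-- Since $(1+z)^{\mathrm{wt}\,v}z^{-j-2}$ gives elements of $O(M)$, poles of orders $j+2$ and $j+1$
with exponent $\mathrm{wt}\,v-1$ are opposite modulo $O(M)$. -/
theorem mkQ_bres_add (hvk : v ∈ A.weight k') (j : ℕ) (x : M) :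
    (zhuO A N).mkQ (N.bres ((k' : ℂ) / 2 - 1) (1 + j) v x)
      = (-1 : ℂ) ^ j • (zhuO A N).mkQ (N.bres ((k' : ℂ) / 2 - 1) 1 v x) := by
  induction j with
  | zero => simp
  | succ j ih =>
    have h := bres_mem_zhuO N hvk x 0 (α := (k' : ℂ) / 2 - 1 + 1) (s := 1 + (j + 1 : ℕ))
      (by simp) (by push_cast; omega)
    rw [N.bres_add_one, show (1 : ℤ) + (j + 1 : ℕ) - 1 = 1 + j by push_cast; ring,
      ← Submodule.ker_mkQ (zhuO A N), LinearMap.mem_ker, map_add, ih] at h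
    rw [eq_neg_of_add_eq_zero_left h, pow_succ, mul_neg_one, neg_smul]

theorem sum_neg_one_pow_smul_add {X : Type*} [AddCommGroup X] [Module ℂ X] (x : ℕ → X) (J : ℕ) :
    ∑ i ∈ range J, (-1 : ℂ) ^ (i + 1) • (x i + x (i + 1)) = (-1 : ℂ) ^ J • x J - x 0 := by
  induction J with
  | zero => simp
  | succ J ih =>
    rw [sum_range_succ, ih, pow_succ]
    module

/-- With exponent $\mathrm{wt}\,v-1$ the terms with $v$ outside no longer vanish. Modulo $O(M)$ they
alternate in sign and telescope to minus the contribution of $(1+z)^{\mathrm{wt}\,u-1}$. Commuting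
$u$ past $v$ in the remaining term gives $(1+z)^{\mathrm{wt}\,u}z^{-1}$, and the difference of the
two series is $(1+z)^{\mathrm{wt}\,u-1}z^{-1}$. -/
theorem mkQ_zhuOp_star (hup : u ∈ A.deg p) (huk : u ∈ A.weight k) (hvq : v ∈ A.deg q)
    (hvk : v ∈ A.weight k') (w : M) :
    (zhuO A N).mkQ (zhuOp N (-1) 1 (A.adjoint.bres ((k : ℂ) / 2) 1 u v) w)
      = (-1 : ℂ) ^ (p * q) • (zhuO A N).mkQ
        (N.bres ((k' : ℂ) / 2 - 1) 1 v (N.bres ((k : ℂ) / 2 - 1) 1 u w)) := by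
  obtain ⟨I, hI⟩ := zhuOp_bres N hup huk hvq hvk (-1) 1 (β := (k' : ℂ) / 2 - 1)
    (by push_cast; ring) w
  obtain ⟨K, hK⟩ := exists_mode_eq_zero N.Y u w
  set E : ℕ → M := fun i => N.bres ((k : ℂ) / 2 - 1) (-i) u w
  have hE : ∀ i : ℕ, N.bres ((k : ℂ) / 2) (-i) u w = E i + E (i + 1) := fun i => by
    have h := N.bres_add_one ((k : ℂ) / 2 - 1) (-i) u w
    rw [sub_add_cancel] at h
    rw [h, show -(i : ℤ) - 1 = -((i + 1 : ℕ) : ℤ) by push_cast; ring]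
  -- The cutoff is taken so large that the upper end `E J` of the telescope vanishes by truncation.
  set J := max (I + 1) K.toNat
  have hEJ : E J = 0 := by
    refine residue_eq_zero N.Y hK (laurentGE_anti ?_ (binom_mem_laurentGE _ _))
    have : K.toNat ≤ J := le_max_right _ _
    omega
  set L : M →ₗ[ℂ] M ⧸ zhuO A N := (zhuO A N).mkQ ∘ₗ N.bres ((k' : ℂ) / 2 - 1) 1 v
  have hsum : ∀ J : ℕ, 1 ≤ J →
      ∑ i ∈ range J, (zhuO A N).mkQ (N.bres ((k : ℂ) / 2) (1 + i) u
        (N.bres ((k' : ℂ) / 2 - 1) (1 - i) v w))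
      = (zhuO A N).mkQ (N.bres ((k : ℂ) / 2) 1 u (N.bres ((k' : ℂ) / 2 - 1) 1 v w)) := by
    intro J hJ
    rw [sum_eq_single 0]
    · simp
    · intro i _ hi
      rw [← LinearMap.mem_ker, Submodule.ker_mkQ]
      exact bres_mem_zhuO N huk _ 0 (by simp) (by push_cast; omega)
    · intro h
      rw [mem_range] at h
      omega
  have hcomm := bres_comm_mem_zhuO N hup huk hvq hvk 0 (α := (k : ℂ) / 2)
    (β := (k' : ℂ) / 2 - 1) (t := 1) (by push_cast; ring) (by simp) w
  rw [← Submodule.ker_mkQ (zhuO A N), LinearMap.mem_ker, map_sub, sub_eq_zero, map_smul] at hcomm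
  have hterm : ∀ i : ℕ, (zhuO A N).mkQ (((-1 : ℂ) ^ i * Ring.choose (-((1 : ℤ) : ℂ)) i) •
      (N.bres ((k : ℂ) / 2) (1 + i) u (N.bres ((k' : ℂ) / 2 - 1) (1 - i) v w)
        - ((-1 : ℂ) ^ (-1 : ℤ) * (-1 : ℂ) ^ (p * q)) •
          N.bres ((k' : ℂ) / 2 - 1) (1 + 1 + i) v (N.bres ((k : ℂ) / 2) (-i) u w)))
      = (zhuO A N).mkQ (N.bres ((k : ℂ) / 2) (1 + i) u (N.bres ((k' : ℂ) / 2 - 1) (1 - i) v w))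
        + (-1 : ℂ) ^ (p * q) • ((-1 : ℂ) ^ (i + 1) • (L (E i) + L (E (i + 1)))) := by
    intro i
    have h := mkQ_bres_add N hvk (i + 1) (N.bres ((k : ℂ) / 2) (-i) u w)
    rw [show (1 : ℤ) + (i + 1 : ℕ) = 1 + 1 + i by push_cast; ring] at h
    rw [neg_one_pow_mul_choose, one_smul, map_sub, map_smul, h, hE, ← map_add, zpow_neg_one]
    simp only [L, LinearMap.comp_apply]
    rw [inv_neg_one]
    module
  have hJ : 1 ≤ J := le_trans (by omega) (le_max_left (I + 1) K.toNat)
  have hJI : J ≥ I := le_trans (by omega) (le_max_left (I + 1) K.toNat)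
  rw [hI J hJI, map_sum, sum_congr rfl fun i _ => hterm i, sum_add_distrib, hsum J hJ, hcomm,
    ← smul_sum, sum_neg_one_pow_smul_add fun i => L (E i), hEJ, map_zero, smul_zero, zero_sub]
  have h2 := N.bres_add_one ((k : ℂ) / 2 - 1) 1 u w
  rw [sub_add_cancel, sub_self] at h2
  have hE0 : E 0 = N.bres ((k : ℂ) / 2 - 1) 0 u w := by simp [E]
  rw [h2, hE0, map_add, map_add]
  simp only [L, LinearMap.comp_apply]
  module

end Congruences

/-! ### Filtrations, parity and Leibniz pairings. -/

section Graded

variable {X X' X'' : Type*} [AddCommGroup X] [Module ℂ X] [AddCommGroup X'] [Module ℂ X']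
  [AddCommGroup X''] [Module ℂ X'']

/-- The span of the subspaces of degree at most `p`. -/
def DGSpace.fil (C : DGSpace X) (p : ℤ) : Submodule ℂ X := ⨆ (q : ℤ) (_ : q ≤ p), C.deg q

theorem DGSpace.mem_fil (C : DGSpace X) {p q : ℤ} (h : q ≤ p) {x : X} (hx : x ∈ C.deg q) :
    x ∈ C.fil p :=
  Submodule.mem_iSup_of_mem q (Submodule.mem_iSup_of_mem h hx)

theorem DGSpace.fil_mono (C : DGSpace X) : Monotone C.fil :=
  fun _ _ h => iSup₂_le fun _ hq _ hx => C.mem_fil (hq.trans h) hx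

theorem DGSpace.fil_induction (C : DGSpace X) {p : ℤ} {P : X → Prop} (zero : P 0)
    (mem : ∀ q ≤ p, ∀ x ∈ C.deg q, P x) (add : ∀ x y, P x → P y → P (x + y)) {x : X}
    (hx : x ∈ C.fil p) : P x := by
  rw [DGSpace.fil, iSup_subtype'] at hx
  exact Submodule.iSup_induction _ (motive := P) hx (fun q x hx => mem q q.2 x hx) zero add

theorem DGSpace.d_mem_fil (C : DGSpace X) {p : ℤ} {x : X} (hx : x ∈ C.fil p) :
    C.d x ∈ C.fil (p + 1) :=
  C.fil_induction (P := fun x => C.d x ∈ C.fil (p + 1)) (by simp)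
    (fun q hq x hx => C.mem_fil (by omega) (C.d_mem q x hx))
    (fun x y hx hy => by rw [map_add]; exact Submodule.add_mem _ hx hy) hx

theorem DGSpace.exists_mem_fil (C : DGSpace X) (x : X) : ∃ i, x ∈ C.fil i := by
  revert x
  refine C.induction ⟨0, Submodule.zero_mem _⟩ (fun p x hx => ⟨p, C.mem_fil le_rfl hx⟩) ?_
  rintro x y ⟨i, hi⟩ ⟨j, hj⟩
  exact ⟨max i j, Submodule.add_mem _ (C.fil_mono (le_max_left i j) hi)
    (C.fil_mono (le_max_right i j) hj)⟩

/-- The span of the subspaces whose degree has the parity of `q`. -/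
def DGSpace.parity (C : DGSpace X) (q : ℤ) : Submodule ℂ X := ⨆ j : ℤ, C.deg (q + 2 * j)

theorem DGSpace.mem_parity (C : DGSpace X) {q : ℤ} (j : ℤ) {r : ℤ} (h : r = q + 2 * j) {x : X}
    (hx : x ∈ C.deg r) : x ∈ C.parity q :=
  Submodule.mem_iSup_of_mem j (h ▸ hx)

theorem DGSpace.parity_induction (C : DGSpace X) {q : ℤ} {P : X → Prop} (zero : P 0)
    (mem : ∀ j, ∀ x ∈ C.deg (q + 2 * j), P x) (add : ∀ x y, P x → P y → P (x + y)) {x : X}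
    (hx : x ∈ C.parity q) : P x :=
  Submodule.iSup_induction _ (motive := P) hx mem zero add

theorem neg_one_zpow_add_two_mul (a b : ℤ) : (-1 : ℂ) ^ (a + 2 * b) = (-1 : ℂ) ^ a := by
  rw [zpow_add₀ (by norm_num), zpow_mul]
  norm_num

/-- The operator `x ↦ (-1)^(p e) x` for `x` of degree `p`. -/
def DGSpace.sign (C : DGSpace X) (e : ℤ) : X →ₗ[ℂ] X :=
  glue C.deg_internal fun p => (-1 : ℂ) ^ (p * e) • LinearMap.id

theorem DGSpace.sign_apply (C : DGSpace X) (e : ℤ) {p : ℤ} {x : X} (hx : x ∈ C.parity p) :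
    C.sign e x = (-1 : ℂ) ^ (p * e) • x := by
  refine C.parity_induction (P := fun x => C.sign e x = (-1 : ℂ) ^ (p * e) • x) (by simp) ?_
    (fun x y hx hy => by rw [map_add, hx, hy, smul_add]) hx
  intro j x hx
  rw [DGSpace.sign, glue_apply _ _ hx, add_mul, mul_assoc, neg_one_zpow_add_two_mul]
  rfl

/-- A bilinear map that does not raise the total degree and obeys the Leibniz rule. -/
structure IsLeibnizPairing (C : DGSpace X) (C' : DGSpace X') (C'' : DGSpace X'')
    (B : X →ₗ[ℂ] X' →ₗ[ℂ] X'') : Prop where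
  mem : ∀ p q, ∀ x ∈ C.deg p, ∀ y ∈ C'.deg q, B x y ∈ C''.fil (p + q)
  leibniz : ∀ p q, ∀ x ∈ C.deg p, ∀ y ∈ C'.deg q,
    C''.d (B x y) = B (C.d x) y + (-1 : ℂ) ^ p • B x (C'.d y)

namespace IsLeibnizPairing

variable {C : DGSpace X} {C' : DGSpace X'} {C'' : DGSpace X''} {B : X →ₗ[ℂ] X' →ₗ[ℂ] X''}

theorem mem_fil (h : IsLeibnizPairing C C' C'' B) {i j : ℤ} {x : X} {y : X'} (hx : x ∈ C.fil i)
    (hy : y ∈ C'.fil j) : B x y ∈ C''.fil (i + j) := by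
  refine C.fil_induction (P := fun x => B x y ∈ C''.fil (i + j)) (by simp) (fun p hp x hx => ?_)
    (fun x x' hx hx' => by
      rw [map_add, LinearMap.add_apply]; exact Submodule.add_mem _ hx hx') hx
  refine C'.fil_induction (P := fun y => B x y ∈ C''.fil (i + j)) (by simp)
    (fun q hq y hy => C''.fil_mono (by omega) (h.mem p q x hx y hy))
    (fun y y' hy hy' => by rw [map_add]; exact Submodule.add_mem _ hy hy') hy

theorem d_apply (h : IsLeibnizPairing C C' C'' B) {p : ℤ} {x : X} (hx : x ∈ C.deg p) (y : X') :
    C''.d (B x y) = B (C.d x) y + (-1 : ℂ) ^ p • B x (C'.d y) := by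
  revert y
  refine C'.induction (by simp) (fun q y hy => h.leibniz p q x hx y hy) (fun y y' hy hy' => ?_)
  simp only [map_add, hy, hy', smul_add]
  abel

theorem d_sub_mem_fil (h : IsLeibnizPairing C C' C'' B) {i j : ℤ} {x : X} {y : X'}
    (hx : x ∈ C.fil i) (hy : y ∈ C'.fil j) :
    C''.d (B x y) - (B (C.d x) y + (-1 : ℂ) ^ i • B x (C'.d y)) ∈ C''.fil (i + j) := by
  refine C.fil_induction
    (P := fun x => C''.d (B x y) - (B (C.d x) y + (-1 : ℂ) ^ i • B x (C'.d y)) ∈ C''.fil (i + j))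
    (by simp) (fun p hp x hx => ?_) (fun x x' hx hx' => ?_) hx
  · rw [h.d_apply hx, add_sub_add_left_eq_sub, ← sub_smul]
    -- Only the mismatch between $(-1)^p$ and $(-1)^i$ remains. If $p<i$, the degree lost by $x$
    -- compensates the one gained by $dy$.
    rcases hp.eq_or_lt with rfl | hp
    · simp
    · exact Submodule.smul_mem _ _ (C''.fil_mono (by omega)
        (h.mem_fil (C.mem_fil le_rfl hx) (C'.d_mem_fil hy)))
  · have h := Submodule.add_mem _ hx hx'
    simp only [map_add, LinearMap.add_apply, smul_add] at h ⊢
    convert h using 1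
    abel

end IsLeibnizPairing

/-- A bilinear map compatible with subspaces descends to the quotients. -/
theorem exists_quotient_pairing {O : Submodule ℂ X} {O' : Submodule ℂ X'} {O'' : Submodule ℂ X''}
    (B : X →ₗ[ℂ] X' →ₗ[ℂ] X'') (h : ∀ x ∈ O, ∀ y, B x y ∈ O'') (h' : ∀ x, ∀ y ∈ O', B x y ∈ O'') :
    ∃ b : X ⧸ O →ₗ[ℂ] X' ⧸ O' →ₗ[ℂ] X'' ⧸ O'', ∀ x y,
      b (O.mkQ x) (O'.mkQ y) = O''.mkQ (B x y) := by
  let B₁ : X' ⧸ O' →ₗ[ℂ] X →ₗ[ℂ] X'' ⧸ O'' := O'.liftQ (B.compr₂ O''.mkQ).flip fun y hy => by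
    ext x
    simpa using h' x y hy
  refine ⟨O.liftQ B₁.flip fun x hx => ?_, fun x y => rfl⟩
  ext y
  change O''.mkQ (B x y) = 0
  simpa using h x hx y

theorem IsLeibnizPairing.isDiffFilteredPairing {C : DGSpace X} {C' : DGSpace X'}
    {C'' : DGSpace X''} {B : X →ₗ[ℂ] X' →ₗ[ℂ] X''} (h : IsLeibnizPairing C C' C'' B)
    {O : Submodule ℂ X} {O' : Submodule ℂ X'} {O'' : Submodule ℂ X''}
    {b : X ⧸ O →ₗ[ℂ] X' ⧸ O' →ₗ[ℂ] X'' ⧸ O''}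
    (hb : ∀ x y, b (O.mkQ x) (O'.mkQ y) = O''.mkQ (B x y))
    {d : X ⧸ O →ₗ[ℂ] X ⧸ O} (hd : ∀ x, d (O.mkQ x) = O.mkQ (C.d x))
    {d' : X' ⧸ O' →ₗ[ℂ] X' ⧸ O'} (hd' : ∀ x, d' (O'.mkQ x) = O'.mkQ (C'.d x))
    {d'' : X'' ⧸ O'' →ₗ[ℂ] X'' ⧸ O''} (hd'' : ∀ x, d'' (O''.mkQ x) = O''.mkQ (C''.d x)) :
    IsDiffFilteredPairing (fun p => (C.fil p).map O.mkQ) d (fun p => (C'.fil p).map O'.mkQ) d'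
      (fun p => (C''.fil p).map O''.mkQ) d'' b where
  mem := by
    rintro i j _ ⟨x, hx, rfl⟩ _ ⟨y, hy, rfl⟩
    exact ⟨B x y, h.mem_fil hx hy, (hb x y).symm⟩
  leibniz := by
    rintro i j _ ⟨x, hx, rfl⟩ _ ⟨y, hy, rfl⟩
    refine ⟨_, h.d_sub_mem_fil hx hy, ?_⟩
    rw [hb, hd, hd', hd'', hb, hb, map_sub, map_add, map_smul]

theorem DGSpace.isDiffFiltration (C : DGSpace X) {O : Submodule ℂ X} {d : X ⧸ O →ₗ[ℂ] X ⧸ O}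
    (hd : ∀ x, d (O.mkQ x) = O.mkQ (C.d x)) :
    IsDiffFiltration (fun p => (C.fil p).map O.mkQ) d where
  mono _ _ h := Submodule.map_mono (C.fil_mono h)
  exhaustive x := by
    obtain ⟨x, rfl⟩ := O.mkQ_surjective x
    obtain ⟨i, hi⟩ := C.exists_mem_fil x
    exact ⟨i, x, hi, rfl⟩
  d_mem := by
    rintro i _ ⟨x, hx, rfl⟩
    exact ⟨C.d x, C.d_mem_fil hx, (hd x).symm⟩
  d_d x := by
    obtain ⟨x, rfl⟩ := O.mkQ_surjective x
    rw [hd, hd, C.d_d, map_zero]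

end Graded

/-! ### The three operations on representatives. -/

section Operations

variable {V M : Type*} [AddCommGroup V] [Module ℂ V] [AddCommGroup M] [Module ℂ M] {A : DGVOA V}
  (N : WeakDGModule A M)

/-- Modes of $u$ shift degrees by $|u|$ up to even numbers. A residue is therefore inhomogeneous in
general but has a definite parity, which suffices for signs in iterated products. -/
theorem bres_mem_parity {p q : ℤ} {u : V} {w : M} (hu : u ∈ A.deg p) (hw : w ∈ N.deg q)
    (α : ℂ) (s : ℤ) : N.bres α s u w ∈ N.parity (p + q) := by
  refine residue_mem N.Y _ (fun n _ => ?_) (binom_mem_laurentGE α s)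
  exact N.mem_parity (-n - 1) (by ring) (N.chain.mode_mem p q n u hu w hw)

theorem bres_one_mem_fil {p q : ℤ} {u : V} {w : M} (hu : u ∈ A.deg p) (hw : w ∈ N.deg q)
    (α : ℂ) : N.bres α 1 u w ∈ N.fil (p + q) := by
  refine residue_mem N.Y _ (fun n hn => ?_) (binom_mem_laurentGE α 1)
  exact N.mem_fil (by omega) (N.chain.mode_mem p q n u hu w hw)

theorem d_residue {p : ℤ} {u : V} (hu : u ∈ A.deg p) (w : M) (f : Laurent) :
    N.d (residue N.Y f u w)
      = residue N.Y f (A.d u) w + (-1 : ℂ) ^ p • residue N.Y f u (N.d w) := by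
  obtain ⟨a, ha⟩ := exists_mem_laurentGE f
  let T : Laurent →ₗ[ℂ] M := N.d ∘ₗ residueAt N.Y u w
    - (residueAt N.Y (A.d u) w + (-1 : ℂ) ^ p • residueAt N.Y u (N.d w))
  have hT : IsLaurentContinuous T :=
    ((isLaurentContinuous_residueAt _ _ _).map _).sub
      ((isLaurentContinuous_residueAt _ _ _).add ((isLaurentContinuous_residueAt _ _ _).smul _))
  have h := hT.mem_of_monomials ⊥ (a := a) (fun m _ => by
    have h := N.chain.mode_d p m u hu w
    simp [T, residue_monomial, h]) ha
  exact sub_eq_zero.1 ((Submodule.mem_bot ℂ).1 h)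

/-- $d$ commutes with $L(0)=\omega_1$, because $d\omega=0$ and $\omega$ is even. -/
theorem d_mem_weight {k : ℤ} {u : V} (hu : u ∈ A.weight k) : A.d u ∈ A.weight k := by
  have h := A.chain.mode_d 4 1 A.ω A.ω_mem u
  rw [DGVOA.mem_weight] at hu ⊢
  rw [A.d_ω, hu, ← modeHom_apply, map_zero, LinearMap.zero_apply, map_smul,
    show ((-1 : ℂ) ^ (4 : ℤ)) = 1 by norm_num, one_smul] at h
  exact (sub_eq_zero.1 h.symm).symm

theorem d_mem_zhuO : zhuO A N ≤ (zhuO A N).comap N.d := by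
  refine zhuO_le_of_homogeneous N fun p k u hu hk q m hm => ?_
  rw [Submodule.mem_comap, DGModule.bres, d_residue N hu]
  exact Submodule.add_mem _ (bres_two_mem_zhuO N (d_mem_weight hk) m)
    (Submodule.smul_mem _ _ (bres_two_mem_zhuO N hk _))

theorem zhuOp_mem_fil (c : ℂ) {p q : ℤ} {u : V} {w : M} (hu : u ∈ A.deg p) (hw : w ∈ N.deg q) :
    zhuOp N c 1 u w ∈ N.fil (p + q) := by
  refine A.deg_induction (P := fun u => zhuOp N c 1 u w ∈ N.fil (p + q)) (by simp)
    (fun k u hu hk => ?_) (fun x y hx hy => by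
      rw [map_add, LinearMap.add_apply]; exact Submodule.add_mem _ hx hy) hu
  rw [zhuOp_apply N c 1 hk]
  exact bres_one_mem_fil N hu hw _

theorem d_zhuOp (c : ℂ) {p : ℤ} {u : V} (hu : u ∈ A.deg p) (w : M) :
    N.d (zhuOp N c 1 u w)
      = zhuOp N c 1 (A.d u) w + (-1 : ℂ) ^ p • zhuOp N c 1 u (N.d w) := by
  refine A.deg_induction (P := fun u => N.d (zhuOp N c 1 u w)
    = zhuOp N c 1 (A.d u) w + (-1 : ℂ) ^ p • zhuOp N c 1 u (N.d w)) (by simp)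
    (fun k u hu hk => ?_) (fun x y hx hy => ?_) hu
  · rw [zhuOp_apply N c 1 hk, zhuOp_apply N c 1 (d_mem_weight hk)]
    exact d_residue N hu w _
  · simp only [map_add, LinearMap.add_apply, smul_add, hx, hy]
    abel

theorem isLeibnizPairing_zhuOp :
    IsLeibnizPairing A.toDGSpace N.toDGSpace N.toDGSpace (zhuOp N 0 1) where
  mem _ _ _ hx _ hy := zhuOp_mem_fil N 0 hx hy
  leibniz _ _ _ hx y _ := d_zhuOp N 0 hx y

/-- The bilinear map `(m, u) ↦ (-1)^(|u| |m|) Res_z Y(u, z) (1 + z)^(wt u - 1) z^(-1) m`. -/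
def zhuRight : M →ₗ[ℂ] V →ₗ[ℂ] M :=
  glue N.deg_internal fun q =>
    LinearMap.lcomp ℂ M (A.sign q) ∘ₗ (zhuOp N (-1) 1).flip

theorem zhuRight_apply {p q : ℤ} {u : V} {m : M} (hu : u ∈ A.parity p) (hm : m ∈ N.parity q) :
    zhuRight N m u = (-1 : ℂ) ^ (p * q) • zhuOp N (-1) 1 u m := by
  refine N.parity_induction
    (P := fun m => zhuRight N m u = (-1 : ℂ) ^ (p * q) • zhuOp N (-1) 1 u m) (by simp)
    (fun j m hm => ?_) (fun x y hx hy => by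
      rw [map_add, LinearMap.add_apply, map_add, hx, hy, smul_add]) hm
  rw [zhuRight, glue_apply _ _ hm]
  simp only [LinearMap.comp_apply, LinearMap.lcomp_apply, LinearMap.flip_apply]
  rw [A.sign_apply _ hu, map_smul, LinearMap.smul_apply, mul_add, mul_left_comm,
    neg_one_zpow_add_two_mul]

theorem DGSpace.deg_le_parity {X : Type*} [AddCommGroup X] [Module ℂ X] (C : DGSpace X) {p : ℤ}
    {x : X} (hx : x ∈ C.deg p) : x ∈ C.parity p :=
  C.mem_parity 0 (by ring) hx

theorem zhuRight_apply_deg {p q : ℤ} {u : V} {m : M} (hu : u ∈ A.deg p) (hm : m ∈ N.deg q) :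
    zhuRight N m u = (-1 : ℂ) ^ (p * q) • zhuOp N (-1) 1 u m :=
  zhuRight_apply N (A.deg_le_parity hu) (N.deg_le_parity hm)

theorem isLeibnizPairing_zhuRight :
    IsLeibnizPairing N.toDGSpace A.toDGSpace N.toDGSpace (zhuRight N) where
  mem q p m hm u hu := by
    rw [zhuRight_apply_deg N hu hm, add_comm]
    exact Submodule.smul_mem _ _ (zhuOp_mem_fil N _ hu hm)
  leibniz q p m hm u hu := by
    -- Moving $d$ past $m$ gives one sign $(-1)^q$, and the raised degree of $du$ in the Koszul sign
    -- gives another.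
    have h : (-1 : ℂ) ^ (q + q) = 1 := by
      rw [← two_mul, zpow_mul]
      norm_num
    rw [zhuRight_apply_deg N hu hm, zhuRight_apply_deg N hu (N.d_mem q m hm),
      zhuRight_apply_deg N (A.d_mem p u hu) hm, map_smul, d_zhuOp N _ hu, smul_add, smul_smul,
      smul_smul, ← zpow_add₀ (by norm_num), ← zpow_add₀ (by norm_num), add_comm]
    congr 2
    · congr 1
      ring
    · rw [show q + (p + 1) * q = p * q + (q + q) by ring, zpow_add₀ (by norm_num), h, mul_one]

theorem zhuOp_left_mem_zhuO (x : V) (hx : x ∈ zhuO A A.adjoint) (m : M) :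
    zhuOp N 0 1 x m ∈ zhuO A N := by
  have h : zhuO A A.adjoint ≤ (zhuO A N).comap ((zhuOp N 0 1).flip m) :=
    zhuO_adjoint_le fun p k u hu hk q k' v hv hk' =>
      zhuOp_circ_mem_zhuO N hu hk hv hk' le_rfl (by simp) m
  exact h hx

theorem zhuOp_right_mem_zhuO (u : V) (m : M) (hm : m ∈ zhuO A N) :
    zhuOp N 0 1 u m ∈ zhuO A N := by
  refine A.bihomogeneous_induction (P := fun u => zhuOp N 0 1 u m ∈ zhuO A N) (by simp)
    (fun p k u hu hk => ?_) (fun x y hx hy => by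
      rw [map_add, LinearMap.add_apply]; exact Submodule.add_mem _ hx hy) u
  have h : zhuO A N ≤ (zhuO A N).comap (zhuOp N 0 1 u) :=
    zhuO_le_of_homogeneous N fun q k' v hv hk' _ w _ => by
      -- The exponents exceed $\mathrm{wt}\,u+\mathrm{wt}\,v-1$ by one, and the double pole of
      -- $v\circ w$ just allows it. The reordered product is again of the form $v\circ m$.
      have h := bres_comm_mem_zhuO N hu hk hv hk' 1 (α := (k : ℂ) / 2) (β := (k' : ℂ) / 2)
        (t := 2) (by push_cast; ring) (by norm_num) w
      rw [Submodule.mem_comap, zhuOp_apply N 0 1 hk, add_zero]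
      exact (Submodule.sub_mem_iff_left _
        (Submodule.smul_mem _ _ (bres_two_mem_zhuO N hk' _))).1 h
  exact h hm

theorem zhuRight_left_mem_zhuO (m : M) (hm : m ∈ zhuO A N) (u : V) :
    zhuRight N m u ∈ zhuO A N := by
  refine A.bihomogeneous_induction (P := fun u => zhuRight N m u ∈ zhuO A N) (by simp)
    (fun p k u hu hk => ?_) (fun x y hx hy => by
      rw [map_add]; exact Submodule.add_mem _ hx hy) u
  have h : zhuO A N ≤ (zhuO A N).comap ((zhuRight N).flip u) :=
    zhuO_le_of_homogeneous N fun q k' v hv hk' r w hw => by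
      have h := bres_comm_mem_zhuO N hu hk hv hk' 0 (α := (k : ℂ) / 2 - 1) (β := (k' : ℂ) / 2)
        (t := 2) (by push_cast; ring) (by norm_num) w
      rw [Submodule.mem_comap, LinearMap.flip_apply,
        zhuRight_apply N (A.deg_le_parity hu) (bres_mem_parity N hv hw _ _),
        zhuOp_apply N _ 1 hk, ← sub_eq_add_neg]
      exact Submodule.smul_mem _ _ ((Submodule.sub_mem_iff_left _
        (Submodule.smul_mem _ _ (bres_two_mem_zhuO N hk' _))).1 h)
  exact h hm

theorem zhuRight_right_mem_zhuO (m : M) (x : V) (hx : x ∈ zhuO A A.adjoint) :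
    zhuRight N m x ∈ zhuO A N := by
  revert m
  refine N.toDGSpace.induction (by simp) (fun r m hm => ?_) (fun x y hx hy => by
    rw [map_add, LinearMap.add_apply]; exact Submodule.add_mem _ hx hy)
  have h : zhuO A A.adjoint ≤ (zhuO A N).comap (zhuRight N m) :=
    zhuO_adjoint_le fun p k u hu hk q k' v hv hk' => by
      rw [Submodule.mem_comap,
        zhuRight_apply N (bres_mem_parity A.adjoint hu hv _ _) (N.deg_le_parity hm)]
      exact Submodule.smul_mem _ _
        (zhuOp_circ_mem_zhuO N hu hk hv hk' (n := 0) zero_le_one (by simp) m)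
  exact h hx

theorem bres_vac (α : ℂ) (m : M) : N.bres α 1 A.vac m = m := by
  rw [DGModule.bres, residue_binom_eq_finsum, finsum_eq_single _ 0]
  · rw [Ring.choose_zero_right, one_smul, N.vac_mode, if_pos (by simp)]
  · intro n hn
    rw [N.vac_mode, if_neg (by omega), smul_zero]

theorem adjoint_bres_vac (α : ℂ) (u : V) : A.adjoint.bres α 1 u A.vac = u := by
  rw [DGModule.bres, residue_binom_eq_finsum, finsum_eq_single _ 0]
  · rw [Ring.choose_zero_right, one_smul]
    exact A.creation u
  · intro n hn
    have h : mode A.adjoint.Y (n - 1) u A.vac = 0 := A.creation_nonneg _ _ (by omega)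
    rw [h, smul_zero]

theorem zhuOp_vac (c : ℂ) (m : M) : zhuOp N c 1 A.vac m = m := by
  rw [zhuOp_apply N c 1 A.vac_mem_weight, bres_vac]

theorem zhuOp_adjoint_vac (u : V) : zhuOp A.adjoint 0 1 u A.vac = u := by
  revert u
  refine internal_induction (isInternal_weight A) (by simp) (fun k u hu => ?_)
    (fun x y hx hy => by rw [map_add, LinearMap.add_apply, hx, hy])
  rw [zhuOp_apply A.adjoint 0 1 hu, adjoint_bres_vac]

theorem zhuRight_vac (m : M) : zhuRight N m A.vac = m := by
  revert m
  refine N.toDGSpace.induction (by simp) (fun q m hm => ?_)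
    (fun x y hx hy => by rw [map_add, LinearMap.add_apply, hx, hy])
  rw [zhuRight_apply_deg N A.vac_mem hm, zhuOp_vac, zero_mul, zpow_zero, one_smul]

theorem mkQ_zhuOp_zhuOp (u v : V) (m : M) :
    (zhuO A N).mkQ (zhuOp N 0 1 (zhuOp A.adjoint 0 1 u v) m)
      = (zhuO A N).mkQ (zhuOp N 0 1 u (zhuOp N 0 1 v m)) := by
  revert u
  refine A.bihomogeneous_induction (by simp) (fun p k u hu hk => ?_) (fun x y hx hy => by
    simp only [map_add, LinearMap.add_apply, hx, hy])
  revert v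
  refine A.bihomogeneous_induction (by simp) (fun q k' v hv hk' => ?_) (fun x y hx hy => by
    simp only [map_add, LinearMap.add_apply, hx, hy])
  rw [zhuOp_apply A.adjoint 0 1 hk, zhuOp_apply N 0 1 hk, zhuOp_apply N 0 1 hk', add_zero, add_zero,
    ← sub_eq_zero, ← map_sub, ← LinearMap.mem_ker, Submodule.ker_mkQ]
  exact zhuOp_star_sub_mem_zhuO N hu hk hv hk' m

/-- `mkQ_zhuOp_star` reverses the order of $u$ and $v$, which is what a right action requires; its
sign $(-1)^{pq}$ completes the Koszul signs through $(p+q)r+pq=pr+q(p+r)$. -/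
theorem mkQ_zhuRight_zhuOp (m : M) (u v : V) :
    (zhuO A N).mkQ (zhuRight N m (zhuOp A.adjoint 0 1 u v))
      = (zhuO A N).mkQ (zhuRight N (zhuRight N m u) v) := by
  revert u
  refine A.bihomogeneous_induction (by simp) (fun p k u hu hk => ?_) (fun x y hx hy => by
    simp only [map_add, LinearMap.add_apply, hx, hy])
  revert v
  refine A.bihomogeneous_induction (by simp) (fun q k' v hv hk' => ?_) (fun x y hx hy => by
    simp only [map_add, hx, hy])
  revert m
  refine N.toDGSpace.induction (by simp) (fun r m hm => ?_) (fun x y hx hy => by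
    simp only [map_add, LinearMap.add_apply, hx, hy])
  rw [zhuOp_apply A.adjoint 0 1 hk, add_zero,
    zhuRight_apply N (bres_mem_parity A.adjoint hu hv _ _) (N.deg_le_parity hm), map_smul,
    mkQ_zhuOp_star N hu hk hv hk', zhuRight_apply_deg N hu hm, map_smul, LinearMap.smul_apply,
    zhuOp_apply N (-1) 1 hk,
    zhuRight_apply N (A.deg_le_parity hv) (bres_mem_parity N hu hm _ _), map_smul, map_smul,
    zhuOp_apply N (-1) 1 hk', smul_smul, smul_smul, ← zpow_add₀ (by norm_num),
    ← zpow_add₀ (by norm_num), show (p + q) * r + p * q = p * r + q * (p + r) by ring]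
  rfl

/-- The exponents $\mathrm{wt}\,u$ and $\mathrm{wt}\,v-1$ with simple poles are the extreme case
$n=0$, $t=1$ of `bres_comm_mem_zhuO`. -/
theorem mkQ_zhuRight_zhuOp_comm (u : V) (m : M) (v : V) :
    (zhuO A N).mkQ (zhuRight N (zhuOp N 0 1 u m) v)
      = (zhuO A N).mkQ (zhuOp N 0 1 u (zhuRight N m v)) := by
  revert u
  refine A.bihomogeneous_induction (by simp) (fun p k u hu hk => ?_) (fun x y hx hy => by
    simp only [map_add, LinearMap.add_apply, hx, hy])
  revert v
  refine A.bihomogeneous_induction (by simp) (fun q k' v hv hk' => ?_) (fun x y hx hy => by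
    simp only [map_add, hx, hy])
  revert m
  refine N.toDGSpace.induction (by simp) (fun r m hm => ?_) (fun x y hx hy => by
    simp only [map_add, LinearMap.add_apply, hx, hy])
  have h := bres_comm_mem_zhuO N hu hk hv hk' 0 (α := (k : ℂ) / 2) (β := (k' : ℂ) / 2 - 1)
    (t := 1) (by push_cast; ring) (by norm_num) m
  rw [← Submodule.ker_mkQ (zhuO A N), LinearMap.mem_ker, map_sub, sub_eq_zero, map_smul] at h
  rw [zhuRight_apply_deg N hv hm, zhuOp_apply N 0 1 hk, add_zero, map_smul, map_smul,
    zhuRight_apply N (A.deg_le_parity hv) (bres_mem_parity N hu hm _ _), map_smul,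
    zhuOp_apply N (-1) 1 hk', ← sub_eq_add_neg, h, smul_smul, ← zpow_add₀ (by norm_num),
    show q * (p + r) = q * r + p * q by ring]

end Operations

end

/-! ### Descent to $A(V)$ and $A(M)$. -/

theorem mainTheorem3 {V : Type*} [AddCommGroup V] [Module ℂ V] (A : DGVOA V)
    {M : Type*} [AddCommGroup M] [Module ℂ M] (N : WeakDGModule A M) :
    ∃ (mul : ZhuA A A.adjoint →ₗ[ℂ] ZhuA A A.adjoint →ₗ[ℂ] ZhuA A A.adjoint)
      (l : ZhuA A A.adjoint →ₗ[ℂ] ZhuA A N →ₗ[ℂ] ZhuA A N)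
      (r : ZhuA A N →ₗ[ℂ] ZhuA A A.adjoint →ₗ[ℂ] ZhuA A N)
      (dV : ZhuA A A.adjoint →ₗ[ℂ] ZhuA A A.adjoint) (dM : ZhuA A N →ₗ[ℂ] ZhuA A N),
      -- the operations are induced by the residue formulas on homogeneous vectors
      (∀ k : ℤ, ∀ u ∈ A.weight k, ∀ v : V,
        mul (zhuClass A A.adjoint u) (zhuClass A A.adjoint v)
          = zhuClass A A.adjoint (A.adjoint.res ((k : ℂ) / 2) 1 u v)) ∧
      (∀ k : ℤ, ∀ u ∈ A.weight k, ∀ m : M,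
        l (zhuClass A A.adjoint u) (zhuClass A N m)
          = zhuClass A N (N.res ((k : ℂ) / 2) 1 u m)) ∧
      (∀ k p q : ℤ, ∀ u ∈ A.weight k, u ∈ A.deg p → ∀ m ∈ N.deg q,
        r (zhuClass A N m) (zhuClass A A.adjoint u)
          = zhuClass A N ((-1 : ℂ) ^ (p * q) • N.res ((k : ℂ) / 2 - 1) 1 u m)) ∧
      (∀ v : V, dV (zhuClass A A.adjoint v) = zhuClass A A.adjoint (A.d v)) ∧
      (∀ m : M, dM (zhuClass A N m) = zhuClass A N (N.d m)) ∧
      -- the algebra and bimodule axioms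
      IsAssocAlgebra mul (zhuClass A A.adjoint A.vac) ∧
      IsBimodule mul (zhuClass A A.adjoint A.vac) l r ∧
      -- compatibility with the differentials and the degree filtrations
      IsDiffFiltration (zhuF A A.adjoint) dV ∧
      IsDiffFiltration (zhuF A N) dM ∧
      IsDiffFilteredPairing (zhuF A A.adjoint) dV (zhuF A A.adjoint) dV
        (zhuF A A.adjoint) dV mul ∧
      IsDiffFilteredPairing (zhuF A A.adjoint) dV (zhuF A N) dM (zhuF A N) dM l ∧
      IsDiffFilteredPairing (zhuF A N) dM (zhuF A A.adjoint) dV (zhuF A N) dM r := by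
  obtain ⟨mul, hmul⟩ := exists_quotient_pairing (zhuOp A.adjoint 0 1)
    (zhuOp_left_mem_zhuO A.adjoint) (zhuOp_right_mem_zhuO A.adjoint)
  obtain ⟨l, hl⟩ := exists_quotient_pairing (zhuOp N 0 1) (zhuOp_left_mem_zhuO N)
    (zhuOp_right_mem_zhuO N)
  obtain ⟨r, hr⟩ := exists_quotient_pairing (zhuRight N) (zhuRight_left_mem_zhuO N)
    (zhuRight_right_mem_zhuO N)
  have hdV : ∀ v, (zhuO A A.adjoint).mapQ _ A.d (d_mem_zhuO A.adjoint) (zhuClass A A.adjoint v)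
    = zhuClass A A.adjoint (A.d v) := fun _ => rfl
  have hdM : ∀ m, (zhuO A N).mapQ _ N.d (d_mem_zhuO N) (zhuClass A N m)
    = zhuClass A N (N.d m) := fun _ => rfl
  refine ⟨mul, l, r, _, _, fun k u hu v => ?_, fun k u hu m => ?_, fun k p q u hu hp m hm => ?_,
    hdV, hdM, ⟨fun a b c => ?_, fun a => ?_, fun a => ?_⟩,
    ⟨fun x => ?_, fun a b x => ?_, fun x => ?_, fun x a b => ?_, fun a x b => ?_⟩,
    A.toDGSpace.isDiffFiltration hdV, N.toDGSpace.isDiffFiltration hdM,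
    (isLeibnizPairing_zhuOp A.adjoint).isDiffFilteredPairing hmul hdV hdV hdV,
    (isLeibnizPairing_zhuOp N).isDiffFilteredPairing hl hdV hdM hdM,
    (isLeibnizPairing_zhuRight N).isDiffFilteredPairing hr hdM hdV hdM⟩
  · rw [hmul, zhuOp_apply A.adjoint 0 1 hu, add_zero, DGModule.res_eq_bres]
  · rw [hl, zhuOp_apply N 0 1 hu, add_zero, DGModule.res_eq_bres]
  · rw [hr, zhuRight_apply_deg N hp hm, zhuOp_apply N _ 1 hu, ← sub_eq_add_neg,
      DGModule.res_eq_bres]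
  · obtain ⟨a, rfl⟩ := Submodule.mkQ_surjective _ a
    obtain ⟨b, rfl⟩ := Submodule.mkQ_surjective _ b
    obtain ⟨c, rfl⟩ := Submodule.mkQ_surjective _ c
    rw [hmul, hmul, hmul, hmul, mkQ_zhuOp_zhuOp A.adjoint]
  · obtain ⟨a, rfl⟩ := Submodule.mkQ_surjective _ a
    rw [hmul, zhuOp_vac]
  · obtain ⟨a, rfl⟩ := Submodule.mkQ_surjective _ a
    rw [hmul, zhuOp_adjoint_vac]
  · obtain ⟨x, rfl⟩ := Submodule.mkQ_surjective _ x
    rw [hl, zhuOp_vac]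
  · obtain ⟨a, rfl⟩ := Submodule.mkQ_surjective _ a
    obtain ⟨b, rfl⟩ := Submodule.mkQ_surjective _ b
    obtain ⟨x, rfl⟩ := Submodule.mkQ_surjective _ x
    rw [hmul, hl, hl, hl, mkQ_zhuOp_zhuOp N]
  · obtain ⟨x, rfl⟩ := Submodule.mkQ_surjective _ x
    rw [hr, zhuRight_vac]
  · obtain ⟨a, rfl⟩ := Submodule.mkQ_surjective _ a
    obtain ⟨b, rfl⟩ := Submodule.mkQ_surjective _ b
    obtain ⟨x, rfl⟩ := Submodule.mkQ_surjective _ x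
    rw [hmul, hr, hr, hr, mkQ_zhuRight_zhuOp N]
  · obtain ⟨a, rfl⟩ := Submodule.mkQ_surjective _ a
    obtain ⟨b, rfl⟩ := Submodule.mkQ_surjective _ b
    obtain ⟨x, rfl⟩ := Submodule.mkQ_surjective _ x
    rw [hl, hr, hr, hl, mkQ_zhuRight_zhuOp_comm N]
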